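/- Let $n\ge 2$ and $\delta\in(0,1]$, and let $f:\mathbb{R}^n\to\mathbb{R}^n$ be a nonconstant $\delta$-monotone map, that is, $$\langle f(x)-f(y),\,x-y\rangle\ \ge\ \delta\,|f(x)-f(y)|\,|x-y|\qquad\text{for all }x,y\in\mathbb{R}^n .$$ Then $f$ is differentiable at almost every point, $f$ and its almost everywhere defined derivative $Df$ are locally integrable, $Df$ is also the weak derivative of $f$, and the weight $\|Df\|$ (operator norm of $Df$) is isotropic doubling: there is a constant $A\ge 1$ such that $$A^{-1}\ \le\ \frac{\int_{R_1}\|Df(x)\|\,dx}{\int_{R_2}\|Df(x)\|\,dx}\ \le\ A$$ whenever $R_1,R_2\subset\mathbb{R}^n$ are congruent closed rectangular boxes (with positive side lengths, and of arbitrary orientation and aspect ratio) with $R_1\cap R_2\ne\varnothing$; in particular these integrals are positive and finite. -/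

import Mathlib

open MeasureTheory
open scoped ENNReal NNReal ContDiff

/-- A map `f : ℝⁿ → ℝⁿ` (Euclidean norm and inner product) is `δ`-monotone, `δ ∈ (0, 1]`. -/
def IsDeltaMonotone {n : ℕ} (δ : ℝ)
    (f : EuclideanSpace ℝ (Fin n) → EuclideanSpace ℝ (Fin n)) : Prop :=
  0 < δ ∧ δ ≤ 1 ∧ ∀ x y, δ * ‖f x - f y‖ * ‖x - y‖ ≤ inner ℝ (f x - f y) (x - y)

/-- The locally integrable field `G` of linear maps is the weak (distributional) derivative
of the locally integrable map `f : ℝⁿ → ℝⁿ`. -/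
def HasWeakDerivative {n : ℕ} (f : EuclideanSpace ℝ (Fin n) → EuclideanSpace ℝ (Fin n))
    (G : EuclideanSpace ℝ (Fin n) → EuclideanSpace ℝ (Fin n) →L[ℝ] EuclideanSpace ℝ (Fin n)) :
    Prop :=
  LocallyIntegrable f volume ∧ LocallyIntegrable G volume ∧
    ∀ φ : EuclideanSpace ℝ (Fin n) → ℝ, ContDiff ℝ ∞ φ → HasCompactSupport φ →
      ∀ v : EuclideanSpace ℝ (Fin n),
        ∫ x, (fderiv ℝ φ x v) • f x = - ∫ x, φ x • G x v

/-- A (closed, nondegenerate) rectangular box of arbitrary orientation: the image of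
`[0, a₁] × ⋯ × [0, aₙ]`, with all `aᵢ > 0`, under an isometry of `ℝⁿ`. -/
def IsRectangularBox {n : ℕ} (R : Set (EuclideanSpace ℝ (Fin n))) : Prop :=
  ∃ (a : Fin n → ℝ) (g : EuclideanSpace ℝ (Fin n) ≃ᵢ EuclideanSpace ℝ (Fin n)),
    (∀ i, 0 < a i) ∧ R = g '' {x | ∀ i, 0 ≤ x i ∧ x i ≤ a i}

/-- Two subsets of `ℝⁿ` are congruent if an isometry of `ℝⁿ` maps one onto the other. -/
def AreCongruent {n : ℕ} (S T : Set (EuclideanSpace ℝ (Fin n))) : Prop :=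
  ∃ g : EuclideanSpace ℝ (Fin n) ≃ᵢ EuclideanSpace ℝ (Fin n), g '' S = T

/-- A Radon (that is, locally finite Borel) measure on `ℝⁿ` is isotropic doubling if
`A⁻¹ ≤ μ(R₁)/μ(R₂) ≤ A` for all intersecting congruent rectangular boxes, with one constant `A`.
The quotient is taken in `[0, ∞]`, where `0/0 = ∞/∞ = 0` and `c/0 = ∞` for `c ≠ 0`. As `A` is
finite, the two bounds force `0 < μ(R) < ∞` for every box. -/
def IsIsotropicDoubling {n : ℕ} (μ : Measure (EuclideanSpace ℝ (Fin n))) : Prop :=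
  IsLocallyFiniteMeasure μ ∧ ∃ A : ℝ≥0, 1 ≤ A ∧
    ∀ R₁ R₂ : Set (EuclideanSpace ℝ (Fin n)), IsRectangularBox R₁ → IsRectangularBox R₂ →
      AreCongruent R₁ R₂ → (R₁ ∩ R₂).Nonempty →
        (A : ℝ≥0∞)⁻¹ ≤ μ R₁ / μ R₂ ∧ μ R₁ / μ R₂ ≤ (A : ℝ≥0∞)

/-- A weight on `ℝⁿ`: a nonnegative locally integrable function. -/
def IsWeight {n : ℕ} (w : EuclideanSpace ℝ (Fin n) → ℝ) : Prop :=
  (∀ x, 0 ≤ w x) ∧ LocallyIntegrable w volume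

/-- A weight `w` is isotropic doubling if the measure `w dℒⁿ` is. -/
def IsIsotropicDoublingWeight {n : ℕ} (w : EuclideanSpace ℝ (Fin n) → ℝ) : Prop :=
  IsWeight w ∧ IsIsotropicDoubling (volume.withDensity fun x => ENNReal.ofReal (w x))

/-!
A `δ`-monotone map with `n ≥ 2` is weakly quasisymmetric (`exists_quasisymmetry`): the increment
`f z - f x` is constrained to a cone about `z - x`, so comparing the values at `x`, `v` and `z`
bounds `|f z - f x|` by a multiple of `|f v - f x|` when `z - x` is short and nearly parallel to
`v - x`. Since `n ≥ 2`, every direction is reached from every other one through a bounded number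
of such small turns. Quasisymmetry yields continuity and the alternative "injective or constant".
Applied to the linear map `Df x`, which is again `δ`-monotone, it shows that
`‖Df x‖`, `⟪Df x e, e⟫` and `|det (Df x)| ^ (1 / n)` are comparable for every unit vector `e`
(`exists_opNorm_le`, `pow_norm_le_det`).

Almost everywhere differentiability holds for continuous monotone maps in general: by Minty's
parametrization, `f` is read off from the Lipschitz map `(id + f)⁻¹`
(`IsDeltaMonotone.ae_differentiableAt`).

The absence of a singular part of the distributional derivative is where `δ`-monotonicity is used
fully. Mollification preserves `δ`-monotonicity, and for smooth `g` the change of variables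
formula bounds `∫ ‖Dg‖ ^ n` over a ball by the volume of its image (`exists_energy_le`), uniformly
along the mollification. As `n > 1`, this makes the difference quotients of `f` uniformly
integrable on balls, so they converge to `Df` in `L¹` by Vitali's theorem
(`IsDeltaMonotone.tendsto_eLpNorm_quotient`). Hence integrals of translates of `f` may be
differentiated under the integral sign (`IsDeltaMonotone.hasDerivAt_integral_smul`), which gives
the weak derivative.

For a box `R` with longest side in the direction `e` and diameter `d`, the mean value theorem for
`s ↦ ∫ x in S, ⟪f (x + s • e), e⟫`, with `S` a half or the double of `R`, shows that
`∫ x in R, ‖Df x‖` is comparable to `(|R| / d) |f (x₀ + v) - f x₀|` for any `x₀ ∈ R` and `|v| = d`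
(`exists_box_bounds`). For two intersecting congruent boxes one takes the same `x₀` and `v`.
-/

/-! ### Quasisymmetry -/

namespace IsDeltaMonotone

variable {n : ℕ} {δ : ℝ} {f : EuclideanSpace ℝ (Fin n) → EuclideanSpace ℝ (Fin n)}

/-- The basic comparison: expand the monotonicity inequality for the pair `v`, `z` about `x`. The
sign condition discards the only term that is not controlled by `|f v - f x|` or absorbed. -/
theorem norm_sub_le_of_inner_nonneg (hf : IsDeltaMonotone δ f)
    {x v z : EuclideanSpace ℝ (Fin n)} (hin : 0 ≤ inner ℝ (f z - f x) (v - x))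
    (hz : ‖z - x‖ ≤ δ / 2 * ‖v - z‖) (hvz : v ≠ z) :
    ‖f z - f x‖ ≤ 4 / δ * ‖f v - f x‖ := by
  obtain ⟨h0, h1, hm⟩ := hf
  have hpos : 0 < ‖v - z‖ := norm_pos_iff.2 (sub_ne_zero.2 hvz)
  have key := hm v z
  have e1 : inner ℝ (f v - f z) (v - z) = inner ℝ (f v - f x) (v - z)
      + inner ℝ (f z - f x) (z - x) - inner ℝ (f z - f x) (v - x) := by
    have a1 : f v - f z = (f v - f x) - (f z - f x) := by abel
    have a2 : v - x = (v - z) + (z - x) := by abel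
    rw [a2, a1, inner_sub_left, inner_add_right]; ring
  have e2 := real_inner_le_norm (f v - f x) (v - z)
  have e3 := real_inner_le_norm (f z - f x) (z - x)
  have e4 : ‖f z - f x‖ - ‖f v - f x‖ ≤ ‖f v - f z‖ := by
    have := norm_sub_norm_le (f z - f x) (f v - f x)
    rwa [sub_sub_sub_cancel_right, norm_sub_rev (f z) (f v)] at this
  have e5 : δ * (‖f z - f x‖ - ‖f v - f x‖) * ‖v - z‖ ≤ δ * ‖f v - f z‖ * ‖v - z‖ := by gcongr
  have e6 : ‖f z - f x‖ * ‖z - x‖ ≤ ‖f z - f x‖ * (δ / 2 * ‖v - z‖) := by gcongr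
  have e7 : (δ / 2 * ‖f z - f x‖) * ‖v - z‖ ≤ ((1 + δ) * ‖f v - f x‖) * ‖v - z‖ := by
    nlinarith
  have e8 := le_of_mul_le_mul_right e7 hpos
  have e9 : (1 + δ) * ‖f v - f x‖ ≤ 2 * ‖f v - f x‖ := by gcongr; linarith
  rw [div_mul_eq_mul_div, le_div_iff₀ h0]
  nlinarith

theorem norm_sub_ray_le (hf : IsDeltaMonotone δ f) (x u : EuclideanSpace ℝ (Fin n))
    {s r : ℝ} (hs : 0 ≤ s) (hsr : s ≤ r) :
    ‖f (x + s • u) - f x‖ ≤ 1 / δ * ‖f (x + r • u) - f x‖ := by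
  obtain ⟨h0, h1, hm⟩ := hf
  rcases hs.eq_or_lt with rfl | hs
  · simp; positivity
  rcases eq_or_ne u 0 with rfl | hu
  · simp
  have hu' : 0 < ‖u‖ := norm_pos_iff.2 hu
  have k1 := hm (x + s • u) x
  have k2 := hm (x + r • u) (x + s • u)
  rw [add_sub_cancel_left, norm_smul, inner_smul_right, Real.norm_of_nonneg hs.le] at k1
  rw [add_sub_add_left_eq_sub, ← sub_smul, inner_smul_right] at k2
  have k3 : 0 ≤ (r - s) * inner ℝ (f (x + r • u) - f (x + s • u)) u :=
    le_trans (by positivity) k2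
  have k4 : δ * ‖f (x + s • u) - f x‖ * ‖u‖ ≤ inner ℝ (f (x + s • u) - f x) u := by
    have : s * (δ * ‖f (x + s • u) - f x‖ * ‖u‖) ≤ s * inner ℝ (f (x + s • u) - f x) u := by
      linarith
    exact le_of_mul_le_mul_left this hs
  have k5 : inner ℝ (f (x + s • u) - f x) u ≤ inner ℝ (f (x + r • u) - f x) u := by
    rcases hsr.eq_or_lt with rfl | h
    · exact le_rfl
    have := nonneg_of_mul_nonneg_right k3 (sub_pos.2 h)
    have e : f (x + r • u) - f x
      = (f (x + r • u) - f (x + s • u)) + (f (x + s • u) - f x) := by abel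
    rw [e, inner_add_left]; linarith
  have k6 := real_inner_le_norm (f (x + r • u) - f x) u
  have k7 := le_of_mul_le_mul_right (k4.trans (k5.trans k6)) hu'
  rw [div_mul_eq_mul_div, le_div_iff₀ h0]; linarith

/-- One step of a chain of directions: the direction may turn by a small angle (in terms of `δ`)
if the radius is shrunk by the factor `δ / 8`. -/
theorem norm_sub_turn_le (hf : IsDeltaMonotone δ f) (x : EuclideanSpace ℝ (Fin n))
    {u v : EuclideanSpace ℝ (Fin n)} (hu : ‖u‖ ≤ 1) (hu' : 1 / 2 ≤ ‖u‖) (hv : 1 / 2 ≤ ‖v‖)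
    (huv : ‖v - u‖ ≤ δ / 2) {r : ℝ} (hr : 0 < r) :
    ‖f (x + (δ / 8 * r) • u) - f x‖ ≤ 4 / δ * ‖f (x + r • v) - f x‖ := by
  obtain ⟨h0, h1, hm⟩ := id hf
  have hc : 0 < δ / 8 * r := by positivity
  have hnz : ‖(δ / 8 * r) • u‖ ≤ δ / 8 * r := by
    rw [norm_smul, Real.norm_of_nonneg hc.le]; nlinarith
  have hnv : r / 2 ≤ ‖r • v‖ := by
    rw [norm_smul, Real.norm_of_nonneg hr.le]; nlinarith
  have hsub : r / 4 ≤ ‖r • v - (δ / 8 * r) • u‖ := by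
    have := norm_sub_norm_le (r • v) ((δ / 8 * r) • u)
    nlinarith
  apply hf.norm_sub_le_of_inner_nonneg
  · have k1 := hm (x + (δ / 8 * r) • u) x
    rw [add_sub_cancel_left, norm_smul, inner_smul_right, Real.norm_of_nonneg hc.le] at k1
    have k2 : δ * ‖f (x + (δ / 8 * r) • u) - f x‖ * ‖u‖
        ≤ inner ℝ (f (x + (δ / 8 * r) • u) - f x) u :=
      le_of_mul_le_mul_left (by linarith) hc
    set w := f (x + (δ / 8 * r) • u) - f x
    have k3 : inner ℝ w v = inner ℝ w u + inner ℝ w (v - u) := by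
      rw [← inner_add_right]; congr 1; abel
    have k4 := abs_real_inner_le_norm w (v - u)
    have k5 := (abs_le.1 k4).1
    rw [add_sub_cancel_left, inner_smul_right]
    have k6 : ‖w‖ * ‖v - u‖ ≤ ‖w‖ * (δ / 2) := by gcongr
    have k7 : δ * ‖w‖ * (1 / 2) ≤ δ * ‖w‖ * ‖u‖ := by gcongr
    have : 0 ≤ inner ℝ w v := by linarith
    positivity
  · rw [add_sub_cancel_left, add_sub_add_left_eq_sub]
    nlinarith
  · intro h
    rw [add_left_cancel h, sub_self, norm_zero] at hsub
    linarith

theorem norm_sub_chain_le (hf : IsDeltaMonotone δ f) (x : EuclideanSpace ℝ (Fin n))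
    {u : ℕ → EuclideanSpace ℝ (Fin n)} (hu : ∀ j, ‖u j‖ ≤ 1) (hu' : ∀ j, 1 / 2 ≤ ‖u j‖)
    (huu : ∀ j, ‖u j - u (j + 1)‖ ≤ δ / 2) (N : ℕ) {r : ℝ} (hr : 0 < r) :
    ‖f (x + ((δ / 8) ^ N * r) • u N) - f x‖ ≤ (4 / δ) ^ N * ‖f (x + r • u 0) - f x‖ := by
  have h0 := hf.1
  induction N with
  | zero => simp
  | succ N ih =>
    have := hf.norm_sub_turn_le x (hu (N + 1)) (hu' _) (hu' _) (huu N)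
      (r := (δ / 8) ^ N * r) (by positivity)
    rw [pow_succ', mul_assoc, pow_succ', mul_assoc]
    exact this.trans (by gcongr)

/-- Turning through an angle of at most `π / 2`, along the segment from `v` to `u`, which stays at
distance at least `1 / 2` from the origin. -/
theorem norm_sub_acute_le (hf : IsDeltaMonotone δ f) (x : EuclideanSpace ℝ (Fin n))
    {u v : EuclideanSpace ℝ (Fin n)} (hu : ‖u‖ = 1) (hv : ‖v‖ = 1) (huv : 0 ≤ inner ℝ v u)
    {N : ℕ} (hN : 4 / δ ≤ N) {r : ℝ} (hr : 0 < r) :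
    ‖f (x + ((δ / 8) ^ N * r) • u) - f x‖ ≤ (4 / δ) ^ N * ‖f (x + r • v) - f x‖ := by
  have h0 := hf.1
  have hN0 : (0 : ℝ) < N := lt_of_lt_of_le (by positivity) hN
  set t : ℕ → ℝ := fun j => min ((j : ℝ) / N) 1 with ht
  have ht0 : ∀ j, 0 ≤ t j := fun j => le_min (by positivity) zero_le_one
  have ht1 : ∀ j, t j ≤ 1 := fun j => min_le_right _ _
  have hcore := hf.norm_sub_chain_le x (u := fun j => (1 - t j) • v + t j • u) ?_ ?_ ?_ N hr
  · have e0 : t 0 = 0 := by simp [ht]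
    have eN : t N = 1 := by simp [ht, div_self hN0.ne']
    simpa [e0, eN] using hcore
  · intro j
    refine (norm_add_le _ _).trans ?_
    rw [norm_smul, norm_smul, hu, hv, Real.norm_of_nonneg (ht0 j),
      Real.norm_of_nonneg (by linarith [ht1 j])]
    linarith
  · intro j
    have e : ‖(1 - t j) • v + t j • u‖ ^ 2 = (1 - t j) ^ 2 + t j ^ 2
        + 2 * ((1 - t j) * t j * inner ℝ v u) := by
      rw [norm_add_sq_real, norm_smul, norm_smul, hu, hv, inner_smul_left, inner_smul_right,
        mul_pow, mul_pow, Real.norm_eq_abs, Real.norm_eq_abs, sq_abs, sq_abs]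
      simp; ring
    have : 0 ≤ (1 - t j) * t j * inner ℝ v u :=
      mul_nonneg (mul_nonneg (by linarith [ht1 j]) (ht0 j)) huv
    refine le_of_sq_le_sq ?_ (norm_nonneg _)
    nlinarith [sq_nonneg (t j - 1 / 2)]
  · intro j
    have e : (1 - t j) • v + t j • u - ((1 - t (j + 1)) • v + t (j + 1) • u)
        = (t (j + 1) - t j) • (v - u) := by
      module
    have hd : ‖t (j + 1) - t j‖ ≤ 1 / N := by
      have a1 : t j ≤ t (j + 1) := by
        refine min_le_min_right _ ?_
        gcongr; simp
      rw [Real.norm_of_nonneg (by linarith)]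
      have a2 : t (j + 1) ≤ t j + 1 / N := by
        simp only [ht, min_add]
        refine min_le_min ?_ ?_
        · push_cast; rw [add_div]
        · have : 0 < 1 / (N : ℝ) := by positivity
          linarith
      linarith
    have hvu : ‖v - u‖ ≤ 2 := by
      refine (norm_sub_le _ _).trans ?_
      rw [hu, hv]; norm_num
    change ‖(1 - t j) • v + t j • u - ((1 - t (j + 1)) • v + t (j + 1) • u)‖ ≤ _
    rw [e, norm_smul]
    calc _ ≤ 1 / (N : ℝ) * 2 := by gcongr
      _ ≤ δ / 2 := by
        rw [div_le_iff₀ h0] at hN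
        rw [one_div, inv_mul_le_iff₀ hN0]; linarith

end IsDeltaMonotone

/-- A direction through which `v` can be turned to `u` by two angles of at most `π / 2`. In dimension
one there is none, and quasisymmetry fails. -/
theorem exists_unit_orthogonal {n : ℕ} (hn : 2 ≤ n) (v u : EuclideanSpace ℝ (Fin n)) :
    ∃ w : EuclideanSpace ℝ (Fin n), ‖w‖ = 1 ∧ inner ℝ v w = 0 ∧ 0 ≤ inner ℝ w u := by
  have hfin : 0 < Module.finrank ℝ (ℝ ∙ v)ᗮ := by
    have h1 := Submodule.finrank_add_finrank_orthogonal (ℝ ∙ v)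
    have h2 := (finrank_span_le_card (R := ℝ) ({v} : Set (EuclideanSpace ℝ (Fin n))))
    rw [finrank_euclideanSpace_fin] at h1
    simp only [Set.toFinset_singleton, Finset.card_singleton] at h2
    omega
  have : Nontrivial (ℝ ∙ v)ᗮ := Module.finrank_pos_iff.1 hfin
  obtain ⟨⟨w, hw⟩, hw0⟩ := exists_ne (0 : (ℝ ∙ v)ᗮ)
  have hw0' : ‖w‖ ≠ 0 := by simpa using hw0
  have hvw : inner ℝ v w = 0 := Submodule.mem_orthogonal_singleton_iff_inner_right.1 hw
  rcases le_total 0 (inner ℝ w u) with h | h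
  · refine ⟨‖w‖⁻¹ • w, ?_, ?_, ?_⟩
    · rw [norm_smul, norm_inv, norm_norm, inv_mul_cancel₀ hw0']
    · rw [inner_smul_right, hvw, mul_zero]
    · rw [inner_smul_left]; simp; positivity
  · refine ⟨-(‖w‖⁻¹ • w), ?_, ?_, ?_⟩
    · rw [norm_neg, norm_smul, norm_inv, norm_norm, inv_mul_cancel₀ hw0']
    · rw [inner_neg_right, inner_smul_right, hvw, mul_zero, neg_zero]
    · rw [inner_neg_left, inner_smul_left, ← mul_neg]
      simp only [conj_trivial]
      exact mul_nonneg (by positivity) (by linarith)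

/-- The weak quasisymmetry of `δ`-monotone maps at a small scale ratio `c`. -/
theorem exists_quasisymmetry_small {n : ℕ} (hn : 2 ≤ n) {δ : ℝ} (h0 : 0 < δ) :
    ∃ c C : ℝ, 0 < c ∧ 0 < C ∧ ∀ f : EuclideanSpace ℝ (Fin n) → EuclideanSpace ℝ (Fin n),
      IsDeltaMonotone δ f → ∀ x v z, ‖z - x‖ ≤ c * ‖v - x‖ →
        ‖f z - f x‖ ≤ C * ‖f v - f x‖ := by
  obtain ⟨N, hN⟩ := exists_nat_ge (4 / δ)
  refine ⟨(δ / 8) ^ N * (δ / 8) ^ N, (4 / δ) ^ N * (4 / δ) ^ N * (1 / δ), by positivity,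
    by positivity, ?_⟩
  intro f hf x v z hz
  set c := (δ / 8) ^ N with hc
  have hc0 : 0 < c := by positivity
  rcases eq_or_ne z x with rfl | hzx
  · simp; positivity
  have hzx' : 0 < ‖z - x‖ := norm_pos_iff.2 (sub_ne_zero.2 hzx)
  have hvx' : 0 < ‖v - x‖ := pos_of_mul_pos_right (hzx'.trans_le hz) (by positivity)
  set zu := ‖z - x‖⁻¹ • (z - x) with hzu
  set vu := ‖v - x‖⁻¹ • (v - x) with hvu
  have nzu : ‖zu‖ = 1 := by
    rw [hzu, norm_smul, norm_inv, norm_norm, inv_mul_cancel₀ hzx'.ne']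
  have nvu : ‖vu‖ = 1 := by
    rw [hvu, norm_smul, norm_inv, norm_norm, inv_mul_cancel₀ hvx'.ne']
  obtain ⟨w, hw, hvw, hwz⟩ := exists_unit_orthogonal hn vu zu
  set r := ‖z - x‖ / (c * c) with hr
  have hr0 : 0 < r := by positivity
  have e1 : x + (c * (c * r)) • zu = z := by
    have : c * (c * r) = ‖z - x‖ := by rw [hr]; field_simp
    rw [this, hzu, smul_smul, mul_inv_cancel₀ hzx'.ne', one_smul, add_sub_cancel]
  have e2 : x + ‖v - x‖ • vu = v := by
    rw [hvu, smul_smul, mul_inv_cancel₀ hvx'.ne', one_smul, add_sub_cancel]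
  have hrv : r ≤ ‖v - x‖ := by
    rw [hr, div_le_iff₀ (by positivity)]; linarith
  have k1 := hf.norm_sub_acute_le x nzu hw hwz hN (r := c * r) (by positivity)
  have k2 := hf.norm_sub_acute_le x hw nvu hvw.ge hN hr0
  have k3 := hf.norm_sub_ray_le x vu hr0.le hrv
  rw [e1] at k1
  rw [e2] at k3
  calc _ ≤ _ := k1
    _ ≤ (4 / δ) ^ N * ((4 / δ) ^ N * (1 / δ * ‖f v - f x‖)) := by gcongr; exact k2.trans (by gcongr)
    _ = _ := by ring

/-- Weak quasisymmetry of `δ`-monotone maps: `|f z - f x| ≤ C |f v - f x|` whenever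
`|z - x| ≤ K |v - x|`, where `C` depends on `δ` and `K` only. -/
theorem exists_quasisymmetry {n : ℕ} (hn : 2 ≤ n) {δ : ℝ} (h0 : 0 < δ) (K : ℝ) :
    ∃ C : ℝ, 0 < C ∧ ∀ f : EuclideanSpace ℝ (Fin n) → EuclideanSpace ℝ (Fin n),
      IsDeltaMonotone δ f → ∀ x v z, ‖z - x‖ ≤ K * ‖v - x‖ →
        ‖f z - f x‖ ≤ C * ‖f v - f x‖ := by
  obtain ⟨c, C₀, hc, hC₀, hcC⟩ := exists_quasisymmetry_small hn h0
  have main : ∀ m : ℕ, ∃ C : ℝ, 0 < C ∧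
      ∀ f : EuclideanSpace ℝ (Fin n) → EuclideanSpace ℝ (Fin n),
      IsDeltaMonotone δ f → ∀ x v z, ‖z - x‖ ≤ m * (c / 2) * ‖v - x‖ →
        ‖f z - f x‖ ≤ C * ‖f v - f x‖ := by
    intro m
    induction m with
    | zero =>
      refine ⟨1, one_pos, fun f hf x v z hz => ?_⟩
      have : z = x := by
        rw [← sub_eq_zero, ← norm_le_zero_iff]; simpa using hz
      rw [this]; simp
    | succ m ih =>
      obtain ⟨C, hC, ih⟩ := ih
      refine ⟨C + C₀ * (C + 1), by positivity, fun f hf x v z hz => ?_⟩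
      push_cast at hz
      have hm : (0 : ℝ) < m + 1 := by positivity
      set z' := x + (m / (m + 1) : ℝ) • (z - x) with hz'
      have d1 : ‖z' - x‖ ≤ m * (c / 2) * ‖v - x‖ := by
        rw [hz', add_sub_cancel_left, norm_smul, Real.norm_of_nonneg (by positivity),
          div_mul_eq_mul_div, div_le_iff₀ hm]
        calc _ ≤ (m : ℝ) * ((m + 1) * (c / 2) * ‖v - x‖) := by gcongr
          _ = _ := by ring
      have d2 : ‖z - z'‖ ≤ c / 2 * ‖v - x‖ := by
        have : z - z' = (1 / (m + 1) : ℝ) • (z - x) := by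
          have : (1 / (m + 1) : ℝ) = 1 - m / (m + 1) := by field_simp; ring
          rw [this, hz']; module
        rw [this, norm_smul, Real.norm_of_nonneg (by positivity), div_mul_eq_mul_div,
          div_le_iff₀ hm]
        linarith
      have i1 := ih f hf x v z' d1
      -- One of `x`, `v` is at distance at least `‖v - x‖ / 2` from `z'`; compare with that one.
      have i2 : ‖f z - f z'‖ ≤ C₀ * (C + 1) * ‖f v - f x‖ := by
        rcases le_total (‖v - x‖ / 2) ‖x - z'‖ with h | h
        · have := hcC f hf z' x z (by nlinarith)
          rw [norm_sub_rev (f x)] at this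
          have hF := norm_nonneg (f v - f x)
          calc _ ≤ _ := this
            _ ≤ C₀ * ((C + 1) * ‖f v - f x‖) := by gcongr; linarith
            _ = _ := by ring
        · have hv : ‖v - x‖ / 2 ≤ ‖v - z'‖ := by
            have := norm_sub_le_norm_sub_add_norm_sub v z' x
            rw [norm_sub_rev z' x] at this
            linarith
          have k := hcC f hf z' v z (by nlinarith)
          have := norm_sub_le_norm_sub_add_norm_sub (f v) (f x) (f z')
          rw [norm_sub_rev (f x)] at this
          calc _ ≤ _ := k
            _ ≤ C₀ * ((C + 1) * ‖f v - f x‖) := by gcongr; linarith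
            _ = _ := by ring
      have := norm_sub_le_norm_sub_add_norm_sub (f z) (f z') (f x)
      linarith
  obtain ⟨m, hm⟩ := exists_nat_ge (K / (c / 2))
  obtain ⟨C, hC, h⟩ := main m
  refine ⟨C, hC, fun f hf x v z hz => h f hf x v z (hz.trans ?_)⟩
  rw [div_le_iff₀ (by positivity)] at hm
  gcongr

namespace IsDeltaMonotone

variable {n : ℕ} {δ : ℝ} {f : EuclideanSpace ℝ (Fin n) → EuclideanSpace ℝ (Fin n)}

theorem injective (hn : 2 ≤ n) (hf : IsDeltaMonotone δ f) (hnc : ∃ x y, f x ≠ f y) :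
    Function.Injective f := by
  intro x v hxv
  by_contra hne
  obtain ⟨y, z, hyz⟩ := hnc
  have hpos : 0 < ‖v - x‖ := norm_pos_iff.2 (sub_ne_zero.2 (Ne.symm hne))
  have key : ∀ z, f z = f x := by
    intro z
    obtain ⟨C, hC, h⟩ := exists_quasisymmetry hn hf.1 (‖z - x‖ / ‖v - x‖)
    have := h f hf x v z (by rw [div_mul_cancel₀ _ hpos.ne'])
    rw [hxv, sub_self, norm_zero, mul_zero] at this
    rw [hxv]
    exact sub_eq_zero.1 (norm_le_zero_iff.1 this)
  exact hyz ((key y).trans (key z).symm)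

/-- On the ray from `x` to `x + u`, the increments of `f` over the `m` dyadic intervals ending at
`x + 2⁻ᵐ u` are, by quasisymmetry, all at least a multiple of `|f (x + 2⁻ᵐ u) - f x|`, and the
sum of their components along `u` telescopes. -/
theorem continuous (hn : 2 ≤ n) (hf : IsDeltaMonotone δ f) : Continuous f := by
  obtain ⟨C, hC, hQ⟩ := exists_quasisymmetry hn hf.1 1
  obtain ⟨h0, h1, hm⟩ := id hf
  obtain ⟨w, hw, -, -⟩ := exists_unit_orthogonal hn 0 0
  rw [continuous_iff_continuousAt]
  intro x
  set a : ℕ → ℝ := fun k => (1 / 2 : ℝ) ^ k with ha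
  have ha0 : ∀ k, 0 < a k := fun k => by simp only [ha]; positivity
  have ha2 : ∀ k, a k - a (k + 1) = a (k + 1) := fun k => by simp only [ha]; ring
  set G : ℕ → EuclideanSpace ℝ (Fin n) := fun k => f (x + a k • w) with hG
  have step : ∀ k, δ / C * ‖G (k + 1) - f x‖ ≤ inner ℝ (G k - G (k + 1)) w := by
    intro k
    have k1 := hm (x + a k • w) (x + a (k + 1) • w)
    rw [add_sub_add_left_eq_sub, ← sub_smul, ha2, norm_smul, hw, inner_smul_right,
      Real.norm_of_nonneg (ha0 _).le] at k1
    have k2 := hQ f hf (x + a (k + 1) • w) (x + a k • w) x (by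
      rw [add_sub_add_left_eq_sub, ← sub_smul, ha2]; simp)
    have k3 : δ * ‖G k - G (k + 1)‖ ≤ inner ℝ (G k - G (k + 1)) w :=
      le_of_mul_le_mul_left (by linarith) (ha0 (k + 1))
    rw [norm_sub_rev (f x)] at k2
    rw [div_mul_eq_mul_div, div_le_iff₀ hC]
    calc δ * ‖G (k + 1) - f x‖ ≤ δ * (C * ‖G k - G (k + 1)‖) := by gcongr
      _ ≤ _ := by nlinarith
  have mono : ∀ k j, ‖G (k + j) - f x‖ ≤ 1 / δ * ‖G k - f x‖ := by
    intro k j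
    apply hf.norm_sub_ray_le x w (ha0 _).le
    exact pow_le_pow_of_le_one (by norm_num) (by norm_num) (by omega)
  have tel : ∀ m : ℕ, (m : ℝ) * (δ / C * (δ * ‖G m - f x‖)) ≤ inner ℝ (G 0 - G m) w := by
    intro m
    have t1 : inner ℝ (G 0 - G m) w = ∑ k ∈ Finset.range m, inner ℝ (G k - G (k + 1)) w := by
      rw [← sum_inner, Finset.sum_range_sub']
    rw [t1]
    calc (m : ℝ) * (δ / C * (δ * ‖G m - f x‖))
        = ∑ k ∈ Finset.range m, δ / C * (δ * ‖G m - f x‖) := by simp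
      _ ≤ _ := by
        refine Finset.sum_le_sum fun k hk => le_trans ?_ (step k)
        gcongr
        obtain ⟨j, rfl⟩ : ∃ j, m = (k + 1) + j :=
          ⟨m - (k + 1), by have := Finset.mem_range.1 hk; omega⟩
        have := mono (k + 1) j
        rw [div_mul_eq_mul_div, one_mul, le_div_iff₀ h0] at this
        linarith
  have bound : ∀ m : ℕ, (m : ℝ) * ‖G m - f x‖ ≤ (1 + 1 / δ) * ‖G 0 - f x‖ * C / δ / δ := by
    intro m
    have b1 : inner ℝ (G 0 - G m) w ≤ (1 + 1 / δ) * ‖G 0 - f x‖ := by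
      have := real_inner_le_norm (G 0 - G m) w
      rw [hw, mul_one] at this
      have b2 := norm_sub_le_norm_sub_add_norm_sub (G 0) (f x) (G m)
      rw [norm_sub_rev (f x)] at b2
      have b3 := mono 0 m
      rw [zero_add] at b3
      linarith
    rw [le_div_iff₀ h0, le_div_iff₀ h0]
    have := (tel m).trans b1
    calc _ = (m : ℝ) * (δ / C * (δ * ‖G m - f x‖)) * C := by field_simp
      _ ≤ _ := by gcongr
  rw [Metric.continuousAt_iff]
  intro ε hε
  obtain ⟨m, hm1⟩ := exists_nat_gt ((1 + 1 / δ) * ‖G 0 - f x‖ * C / δ / δ * C / ε)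
  have hm0 : (0 : ℝ) < m := lt_of_le_of_lt (by positivity) hm1
  refine ⟨a m, ha0 m, fun {z} hz => ?_⟩
  rw [dist_eq_norm] at hz ⊢
  have q := hQ f hf x (x + a m • w) z (by
    rw [add_sub_cancel_left, norm_smul, hw, Real.norm_of_nonneg (ha0 m).le]; linarith)
  refine q.trans_lt ?_
  rw [div_lt_iff₀ hε] at hm1
  have := bound m
  have : (m : ℝ) * (C * ‖G m - f x‖) < m * ε := by
    calc _ = C * (m * ‖G m - f x‖) := by ring
      _ ≤ C * ((1 + 1 / δ) * ‖G 0 - f x‖ * C / δ / δ) := by gcongr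
      _ < _ := by linarith
  exact lt_of_mul_lt_mul_left this hm0.le

end IsDeltaMonotone

/-! ### Differentiability almost everywhere -/

theorem LipschitzWith.volume_image_eq_zero {n : ℕ} {K : ℝ≥0}
    {J : EuclideanSpace ℝ (Fin n) → EuclideanSpace ℝ (Fin n)} (hJ : LipschitzWith K J)
    {s : Set (EuclideanSpace ℝ (Fin n))} (hs : volume s = 0) : volume (J '' s) = 0 := by
  have hfr : Module.finrank ℝ (EuclideanSpace ℝ (Fin n)) = n := finrank_euclideanSpace_fin
  have hH : (Measure.hausdorffMeasure n : Measure (EuclideanSpace ℝ (Fin n))).IsAddHaarMeasure := by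
    have := isAddHaarMeasure_hausdorffMeasure (E := EuclideanSpace ℝ (Fin n))
    rwa [hfr] at this
  have h1 : (Measure.hausdorffMeasure n : Measure (EuclideanSpace ℝ (Fin n))) s = 0 :=
    Measure.absolutelyContinuous_isAddHaarMeasure _ volume hs
  refine Measure.absolutelyContinuous_isAddHaarMeasure volume
    (Measure.hausdorffMeasure n : Measure (EuclideanSpace ℝ (Fin n))) ?_
  refine le_antisymm ((hJ.hausdorffMeasure_image_le n.cast_nonneg s).trans ?_) (zero_le)
  rw [h1, mul_zero]

namespace IsDeltaMonotone

variable {n : ℕ} {δ : ℝ} {f : EuclideanSpace ℝ (Fin n) → EuclideanSpace ℝ (Fin n)}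

/-- Minty's parametrization: `id + f` has a `1`-Lipschitz left inverse `J`. By Rademacher's theorem
and Sard's lemma, `J` is differentiable with invertible derivative at `x + f x` for almost
every `x`, and then `f` is differentiable at `x`. -/
theorem ae_differentiableAt (hf : IsDeltaMonotone δ f) (hc : Continuous f) :
    ∀ᵐ x, DifferentiableAt ℝ f x := by
  obtain ⟨h0, h1, hm⟩ := id hf
  set h : EuclideanSpace ℝ (Fin n) → EuclideanSpace ℝ (Fin n) := fun x => x + f x with hh
  have hanti : ∀ x y, ‖x - y‖ ≤ ‖h x - h y‖ := by
    intro x y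
    have e : h x - h y = (x - y) + (f x - f y) := by simp only [hh]; abel
    have k1 : 0 ≤ inner ℝ (f x - f y) (x - y) := le_trans (by positivity) (hm x y)
    have k2 : ‖x - y‖ * ‖x - y‖ ≤ ‖h x - h y‖ * ‖x - y‖ := by
      refine le_trans ?_ (real_inner_le_norm _ _)
      rw [e, inner_add_left, real_inner_self_eq_norm_mul_norm]
      linarith
    by_contra! hlt
    have := (norm_nonneg _).trans_lt hlt
    nlinarith
  obtain ⟨J₀, hJ₀⟩ : ∃ J₀ : EuclideanSpace ℝ (Fin n) → EuclideanSpace ℝ (Fin n),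
      ∀ x, J₀ (h x) = x := by
    have hinj : Function.Injective h := fun x y hxy => by
      have := hanti x y
      rw [hxy, sub_self, norm_zero] at this
      exact sub_eq_zero.1 (norm_le_zero_iff.1 this)
    exact ⟨Function.invFun h, Function.leftInverse_invFun hinj⟩
  have hlip : LipschitzOnWith 1 J₀ (Set.range h) := by
    refine LipschitzOnWith.of_dist_le_mul ?_
    rintro _ ⟨x, rfl⟩ _ ⟨y, rfl⟩
    rw [hJ₀, hJ₀, dist_eq_norm, dist_eq_norm]
    simpa using hanti x y
  obtain ⟨J, hJ, hJJ⟩ := hlip.extend_finite_dimension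
  have hJh : ∀ x, J (h x) = x := fun x => by rw [← hJJ ⟨x, rfl⟩, hJ₀]
  have hnull1 : volume (J '' {y | ¬ DifferentiableAt ℝ J y}) = 0 :=
    hJ.volume_image_eq_zero (ae_iff.1 hJ.ae_differentiableAt)
  have hnull2 : volume (J '' {y | DifferentiableAt ℝ J y ∧ (fderiv ℝ J y).det = 0}) = 0 :=
    addHaar_image_eq_zero_of_det_fderivWithin_eq_zero volume
      (f' := fderiv ℝ J) (fun y hy => hy.1.hasFDerivAt.hasFDerivWithinAt) (fun y hy => hy.2)
  rw [ae_iff]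
  refine measure_mono_null ?_ (measure_union_null hnull1 hnull2)
  intro x hx
  by_contra hcon
  simp only [Set.mem_union, not_or] at hcon
  obtain ⟨c1, c2⟩ := hcon
  have d1 : DifferentiableAt ℝ J (h x) := by
    by_contra hd
    exact c1 ⟨h x, hd, hJh x⟩
  have d2 : (fderiv ℝ J (h x)).det ≠ 0 := fun hd => c2 ⟨h x, ⟨d1, hd⟩, hJh x⟩
  have hd : HasFDerivAt h _ x := HasFDerivAt.of_local_left_inverse
    (f' := (fderiv ℝ J (h x)).toContinuousLinearEquivOfDetNeZero d2)
    (f := J) (continuous_id.add hc).continuousAt (by simpa using d1.hasFDerivAt)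
    (Filter.Eventually.of_forall hJh)
  apply hx
  have : f = fun x => h x - x := by funext x; simp [hh]
  rw [this]
  exact hd.differentiableAt.sub differentiableAt_id

/-! ### Derivatives of monotone maps -/

theorem hasFDerivAt {A : EuclideanSpace ℝ (Fin n) →L[ℝ] EuclideanSpace ℝ (Fin n)}
    {x : EuclideanSpace ℝ (Fin n)} (hf : IsDeltaMonotone δ f) (hA : HasFDerivAt f A x) :
    IsDeltaMonotone δ A := by
  obtain ⟨h0, h1, hm⟩ := hf
  refine ⟨h0, h1, fun u v => ?_⟩
  rw [← map_sub]
  set w := u - v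
  have hlim := hA.lim w (c := fun k : ℕ => (k : ℝ)) (l := Filter.atTop)
    (by simpa using tendsto_natCast_atTop_atTop)
  refine le_of_tendsto_of_tendsto ((hlim.norm.const_mul δ).mul_const ‖w‖)
    (hlim.inner tendsto_const_nhds) ?_
  filter_upwards [Filter.eventually_gt_atTop 0] with k hk
  have hk' : (0 : ℝ) < k := by exact_mod_cast hk
  have := hm (x + (k : ℝ)⁻¹ • w) x
  rw [add_sub_cancel_left, norm_smul, inner_smul_right, norm_inv,
    Real.norm_of_nonneg hk'.le] at this
  rw [mul_left_comm] at this
  have e := le_of_mul_le_mul_left this (by positivity)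
  rw [norm_smul, inner_smul_left, Real.norm_of_nonneg hk'.le]
  simp only [conj_trivial]
  nlinarith

end IsDeltaMonotone

/-- Quasisymmetry of a `δ`-monotone linear map: it stretches all directions comparably. -/
theorem exists_opNorm_le {n : ℕ} (hn : 2 ≤ n) {δ : ℝ} (h0 : 0 < δ) :
    ∃ C : ℝ, 0 < C ∧ ∀ A : EuclideanSpace ℝ (Fin n) →L[ℝ] EuclideanSpace ℝ (Fin n),
      IsDeltaMonotone δ A → ∀ v, ‖A‖ * ‖v‖ ≤ C * ‖A v‖ := by
  obtain ⟨C, hC, h⟩ := exists_quasisymmetry hn h0 1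
  refine ⟨C, hC, fun A hA v => ?_⟩
  rcases eq_or_ne v 0 with rfl | hv
  · simp
  have hv' : 0 < ‖v‖ := norm_pos_iff.2 hv
  rw [← le_div_iff₀ hv']
  refine A.opNorm_le_bound (by positivity) fun z => ?_
  rcases eq_or_ne z 0 with rfl | hz
  · simp
  have hz' : 0 < ‖z‖ := norm_pos_iff.2 hz
  have := h A hA 0 v ((‖v‖ / ‖z‖) • z) (by
    rw [sub_zero, sub_zero, norm_smul, norm_div, norm_norm, norm_norm, div_mul_cancel₀ _ hz'.ne',
      one_mul])
  rw [map_zero, sub_zero, sub_zero, map_smul, norm_smul, norm_div, norm_norm, norm_norm] at this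
  rw [div_mul_eq_mul_div, le_div_iff₀ hv']
  rw [div_mul_eq_mul_div, div_le_iff₀ hz'] at this
  linarith

/-- The image of the unit ball contains the ball of radius `‖A‖ / C`. -/
theorem pow_norm_le_det {n : ℕ} (hn : 2 ≤ n) {C : ℝ} (hC : 0 < C)
    {A : EuclideanSpace ℝ (Fin n) →L[ℝ] EuclideanSpace ℝ (Fin n)}
    (hA : ∀ v, ‖A‖ * ‖v‖ ≤ C * ‖A v‖) : ‖A‖ ^ n ≤ C ^ n * |A.det| := by
  rcases eq_or_ne A 0 with rfl | hA0
  · rw [norm_zero, zero_pow (by omega)]; positivity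
  have hA' : 0 < ‖A‖ := norm_pos_iff.2 hA0
  have hinj : Function.Injective A := by
    rw [injective_iff_map_eq_zero]
    intro v hv
    have := hA v
    rw [hv, norm_zero, mul_zero] at this
    exact norm_le_zero_iff.1 (le_of_mul_le_mul_left (by simpa using this) hA')
  have hsurj : Function.Surjective A :=
    (LinearMap.injective_iff_surjective
      (f := (A : EuclideanSpace ℝ (Fin n) →ₗ[ℝ] EuclideanSpace ℝ (Fin n)))).1 hinj
  have hsub : Metric.ball 0 (‖A‖ / C) ⊆ A '' Metric.ball 0 1 := by
    intro y hy
    obtain ⟨v, rfl⟩ := hsurj y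
    refine ⟨v, ?_, rfl⟩
    rw [mem_ball_zero_iff] at hy ⊢
    rw [lt_div_iff₀ hC] at hy
    have := hA v
    have : ‖A‖ * ‖v‖ < ‖A‖ * 1 := by linarith
    exact lt_of_mul_lt_mul_left this hA'.le
  have : Nontrivial (EuclideanSpace ℝ (Fin n)) := by
    have : Nonempty (Fin n) := ⟨⟨0, by omega⟩⟩
    infer_instance
  have hvol := measure_mono (μ := volume) hsub
  rw [Measure.addHaar_image_continuousLinearMap, Measure.addHaar_ball _ _ (by positivity),
    finrank_euclideanSpace_fin] at hvol
  have hb0 : volume (Metric.ball (0 : EuclideanSpace ℝ (Fin n)) 1) ≠ 0 :=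
    (Metric.measure_ball_pos _ _ one_pos).ne'
  have hbt : volume (Metric.ball (0 : EuclideanSpace ℝ (Fin n)) 1) ≠ ⊤ :=
    measure_ball_lt_top.ne
  rw [ENNReal.mul_le_mul_iff_left hb0 hbt, ENNReal.ofReal_le_ofReal_iff (abs_nonneg _), div_pow,
    div_le_iff₀ (by positivity)] at hvol
  calc _ ≤ _ := hvol
    _ = _ := mul_comm _ _

/-- The `n`-energy of a differentiable `δ`-monotone map is controlled by the volume of the image:
its Jacobian is comparable to `‖Dg‖ⁿ`, and the change of variables formula applies as the map
is constant or injective. -/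
theorem exists_energy_le {n : ℕ} (hn : 2 ≤ n) {δ : ℝ} (h0 : 0 < δ) :
    ∃ C : ℝ≥0∞, C ≠ ⊤ ∧ ∀ g : EuclideanSpace ℝ (Fin n) → EuclideanSpace ℝ (Fin n),
      IsDeltaMonotone δ g → Differentiable ℝ g → ∀ s, MeasurableSet s →
        ∫⁻ x in s, ‖fderiv ℝ g x‖ₑ ^ n ≤ C * volume (g '' s) := by
  obtain ⟨C, hC, h⟩ := exists_opNorm_le hn h0
  refine ⟨ENNReal.ofReal (C ^ n), ENNReal.ofReal_ne_top, fun g hg hd s hs => ?_⟩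
  by_cases hnc : ∃ x y, g x ≠ g y
  · have hinj := hg.injective hn hnc
    rw [← lintegral_abs_det_fderiv_eq_addHaar_image volume hs
      (fun x _ => (hd x).hasFDerivAt.hasFDerivWithinAt) hinj.injOn,
      ← lintegral_const_mul' _ _ ENNReal.ofReal_ne_top]
    refine lintegral_mono fun x => ?_
    rw [← ENNReal.ofReal_mul (by positivity), ← ofReal_norm,
      ← ENNReal.ofReal_pow (norm_nonneg _)]
    exact ENNReal.ofReal_le_ofReal
      (pow_norm_le_det hn hC (h _ (hg.hasFDerivAt (hd x).hasFDerivAt)))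
  · push Not at hnc
    have : g = fun _ => g 0 := funext fun x => hnc x 0
    have hz : ∀ x, ‖fderiv ℝ g x‖ₑ = 0 := fun x => by rw [← ofReal_norm, this]; simp
    simp [hz, show n ≠ 0 by omega]

/-! ### Smooth approximation and uniform integrability of difference quotients -/

theorem lintegral_le_of_tendsto_of_forall_le {α : Type*} [MeasurableSpace α] {μ : Measure α}
    {F : ℕ → α → ℝ≥0∞} {G : α → ℝ≥0∞} {C : ℝ≥0∞} (hF : ∀ k, Measurable (F k))
    (hlim : ∀ᵐ x ∂μ, Filter.Tendsto (fun k => F k x) Filter.atTop (nhds (G x)))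
    (hC : ∀ k, ∫⁻ x, F k x ∂μ ≤ C) : ∫⁻ x, G x ∂μ ≤ C := by
  calc ∫⁻ x, G x ∂μ = ∫⁻ x, Filter.liminf (fun k => F k x) Filter.atTop ∂μ :=
        lintegral_congr_ae (hlim.mono fun x hx => hx.liminf_eq.symm)
    _ ≤ _ := lintegral_liminf_le hF
    _ ≤ C := Filter.liminf_le_of_frequently_le' (Filter.Frequently.of_forall hC)

namespace IsDeltaMonotone

variable {n : ℕ} {δ : ℝ} {f : EuclideanSpace ℝ (Fin n) → EuclideanSpace ℝ (Fin n)}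

/-- `δ`-monotone maps form a convex cone that is invariant under translations, so mollification
preserves `δ`-monotonicity. -/
theorem convolution_normed (hf : IsDeltaMonotone δ f) (hc : Continuous f)
    (φ : ContDiffBump (0 : EuclideanSpace ℝ (Fin n))) :
    IsDeltaMonotone δ
      (convolution (φ.normed volume) f (ContinuousLinearMap.lsmul ℝ ℝ) volume) := by
  obtain ⟨h0, h1, hm⟩ := hf
  refine ⟨h0, h1, fun x y => ?_⟩
  set ψ := φ.normed (volume : Measure (EuclideanSpace ℝ (Fin n))) with hψ
  have hψ0 : ∀ t, 0 ≤ ψ t := φ.nonneg_normed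
  have hψc : Continuous ψ := φ.continuous_normed
  have hψs : HasCompactSupport ψ := φ.hasCompactSupport_normed
  have hint : ∀ z, Integrable (fun t => ψ t • f (z - t)) := fun z =>
    (hψc.smul (hc.comp (continuous_const.sub continuous_id))).integrable_of_hasCompactSupport
      hψs.smul_right
  have e : convolution ψ f (ContinuousLinearMap.lsmul ℝ ℝ) volume x
      - convolution ψ f (ContinuousLinearMap.lsmul ℝ ℝ) volume y
      = ∫ t, ψ t • (f (x - t) - f (y - t)) := by
    simp only [convolution_def, ContinuousLinearMap.lsmul_apply]
    rw [← integral_sub (hint x) (hint y)]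
    simp only [smul_sub]
  have hI : Integrable (fun t => ψ t • (f (x - t) - f (y - t))) := by
    simp only [smul_sub]
    exact (hint x).sub (hint y)
  rw [e, real_inner_comm, ← integral_inner hI]
  calc δ * ‖∫ t, ψ t • (f (x - t) - f (y - t))‖ * ‖x - y‖
      ≤ δ * (∫ t, ‖ψ t • (f (x - t) - f (y - t))‖) * ‖x - y‖ := by
        gcongr; exact norm_integral_le_integral_norm _
    _ = ∫ t, δ * ‖ψ t • (f (x - t) - f (y - t))‖ * ‖x - y‖ := by
        rw [integral_mul_const, integral_const_mul]
    _ ≤ _ := by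
        refine integral_mono ((hI.norm.const_mul δ).mul_const _) (hI.const_inner _) fun t => ?_
        have := hm (x - t) (y - t)
        rw [sub_sub_sub_cancel_right] at this
        simp only [norm_smul, inner_smul_right, Real.norm_of_nonneg (hψ0 t)]
        rw [real_inner_comm]
        have := mul_le_mul_of_nonneg_left this (hψ0 t)
        linarith

theorem exists_smooth_approx (hf : IsDeltaMonotone δ f) (hc : Continuous f) :
    ∃ g : ℕ → EuclideanSpace ℝ (Fin n) → EuclideanSpace ℝ (Fin n),
      (∀ k, IsDeltaMonotone δ (g k)) ∧ (∀ k, ContDiff ℝ 1 (g k)) ∧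
      (∀ x, Filter.Tendsto (fun k => g k x) Filter.atTop (nhds (f x))) ∧
      ∀ R, ∃ M, ∀ k, ∀ x ∈ Metric.closedBall (0 : EuclideanSpace ℝ (Fin n)) R, ‖g k x‖ ≤ M := by
  set φ : ℕ → ContDiffBump (0 : EuclideanSpace ℝ (Fin n)) := fun k =>
    ⟨1 / ((k : ℝ) + 1) / 2, 1 / ((k : ℝ) + 1), by positivity, half_lt_self (by positivity)⟩ with hφ
  refine ⟨fun k => convolution ((φ k).normed volume) f (ContinuousLinearMap.lsmul ℝ ℝ) volume,
    fun k => hf.convolution_normed hc _, fun k => ?_, fun x => ?_, fun R => ?_⟩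
  · exact HasCompactSupport.contDiff_convolution_left (n := 1) _ (φ k).hasCompactSupport_normed
      (φ k).contDiff_normed hc.locallyIntegrable
  · exact ContDiffBump.convolution_tendsto_right_of_continuous
      (tendsto_one_div_add_atTop_nhds_zero_nat (𝕜 := ℝ)) hc x
  · obtain ⟨M, hM⟩ := (isCompact_closedBall (0 : EuclideanSpace ℝ (Fin n))
      (R + 1)).exists_bound_of_continuousOn hc.continuousOn
    refine ⟨M + 2 * M, fun k x hx => ?_⟩
    have hr : (φ k).rOut ≤ 1 := by
      change 1 / ((k : ℝ) + 1) ≤ 1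
      rw [div_le_one (by positivity)]; simp
    rw [mem_closedBall_zero_iff] at hx
    have hx' : ‖f x‖ ≤ M := hM x (by rw [mem_closedBall_zero_iff]; linarith)
    have := ContDiffBump.dist_normed_convolution_le (φ := φ k) (μ := volume) (g := f) (x₀ := x)
      (ε := 2 * M) hc.aestronglyMeasurable (fun y hy => ?_)
    · rw [dist_eq_norm] at this
      have h2 := norm_sub_norm_le
        (convolution ((φ k).normed volume) f (ContinuousLinearMap.lsmul ℝ ℝ) volume x) (f x)
      linarith
    · have hy' : ‖f y‖ ≤ M := by
        refine hM y ?_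
        rw [mem_closedBall_zero_iff]
        rw [Metric.mem_ball, dist_eq_norm] at hy
        have := norm_sub_norm_le y x
        linarith
      rw [dist_eq_norm]
      exact (norm_sub_le _ _).trans (by linarith)

end IsDeltaMonotone

theorem enorm_add_smul_sub_le {n : ℕ} {g : EuclideanSpace ℝ (Fin n) → EuclideanSpace ℝ (Fin n)}
    (hg : ContDiff ℝ 1 g) (x v : EuclideanSpace ℝ (Fin n)) (s : ℝ) :
    ‖g (x + s • v) - g x‖ₑ
      ≤ ‖s‖ₑ * ‖v‖ₑ * ∫⁻ t in Set.Ioc (0 : ℝ) 1, ‖fderiv ℝ g (x + (t * s) • v)‖ₑ := by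
  have hd : Differentiable ℝ g := hg.differentiable one_ne_zero
  have hcont : Continuous fun t : ℝ => fderiv ℝ g (x + (t * s) • v) :=
    (hg.continuous_fderiv one_ne_zero).comp (by fun_prop)
  have hder : ∀ t : ℝ, HasDerivAt (fun t : ℝ => g (x + (t * s) • v))
      (fderiv ℝ g (x + (t * s) • v) (s • v)) t := by
    intro t
    have h1 : HasDerivAt (fun t : ℝ => x + (t * s) • v) (s • v) t := by
      have := (((hasDerivAt_id t).mul_const s).smul_const v).const_add x
      simpa using this
    exact (hd _).hasFDerivAt.comp_hasDerivAt t h1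
  have hftc := intervalIntegral.integral_eq_sub_of_hasDerivAt (a := 0) (b := 1)
    (fun t _ => hder t) ((hcont.clm_apply continuous_const).intervalIntegrable _ _)
  simp only [one_mul, zero_mul, zero_smul, add_zero] at hftc
  rw [← hftc, intervalIntegral.integral_of_le zero_le_one,
    ← lintegral_const_mul' _ _ (by finiteness)]
  refine (enorm_integral_le_lintegral_enorm _).trans (lintegral_mono fun t => ?_)
  calc _ ≤ ‖fderiv ℝ g (x + (t * s) • v)‖ₑ * ‖s • v‖ₑ := ContinuousLinearMap.le_opENorm _ _
    _ = _ := by rw [enorm_smul, mul_comm]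

theorem ENNReal.le_add_pow_div {n : ℕ} (hn : 1 ≤ n) (a : ℝ≥0∞) {l : ℝ≥0} (hl : l ≠ 0) :
    a ≤ l + a ^ n / (l : ℝ≥0∞) ^ (n - 1) := by
  rcases le_total a l with h | h
  · exact h.trans le_self_add
  · refine le_trans ?_ le_add_self
    rw [ENNReal.le_div_iff_mul_le (Or.inl (by positivity)) (Or.inl (by finiteness))]
    calc a * (l : ℝ≥0∞) ^ (n - 1) ≤ a * a ^ (n - 1) := by gcongr
      _ = a ^ n := by rw [← pow_succ', Nat.sub_add_cancel hn]

theorem setLIntegral_enorm_add_smul_sub_le {n : ℕ} (hn : 1 ≤ n)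
    {g : EuclideanSpace ℝ (Fin n) → EuclideanSpace ℝ (Fin n)} (hg : ContDiff ℝ 1 g)
    (v : EuclideanSpace ℝ (Fin n)) {s : ℝ} (hs : |s| ≤ 1) {R : ℝ} {l : ℝ≥0} (hl : l ≠ 0)
    {E : Set (EuclideanSpace ℝ (Fin n))} (hER : E ⊆ Metric.closedBall 0 R) :
    ∫⁻ x in E, ‖g (x + s • v) - g x‖ₑ ≤ ‖s‖ₑ * ‖v‖ₑ * (l * volume E +
      (∫⁻ x in Metric.closedBall 0 (R + ‖v‖), ‖fderiv ℝ g x‖ₑ ^ n) / (l : ℝ≥0∞) ^ (n - 1)) := by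
  have hcont : Continuous (fderiv ℝ g) := hg.continuous_fderiv one_ne_zero
  set B := Metric.closedBall (0 : EuclideanSpace ℝ (Fin n)) (R + ‖v‖) with hB
  set I := ∫⁻ x in B, ‖fderiv ℝ g x‖ₑ ^ n with hI
  have hslice : ∀ t ∈ Set.Ioc (0 : ℝ) 1, ∫⁻ x in E, ‖fderiv ℝ g (x + (t * s) • v)‖ₑ
      ≤ l * volume E + I / (l : ℝ≥0∞) ^ (n - 1) := by
    intro t ht
    have hshift : ∫⁻ x in E, ‖fderiv ℝ g (x + (t * s) • v)‖ₑ ^ n ≤ I := by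
      rw [hI, ← lintegral_indicator Metric.isClosed_closedBall.measurableSet,
        ← lintegral_add_right_eq_self (μ := volume) _ ((t * s) • v)]
      refine (setLIntegral_mono (g := fun x => B.indicator (fun x => ‖fderiv ℝ g x‖ₑ ^ n)
        (x + (t * s) • v)) ?_ fun x hx => ?_).trans (setLIntegral_le_lintegral _ _)
      · exact ((hcont.enorm.measurable.pow_const n).indicator
          Metric.isClosed_closedBall.measurableSet).comp (measurable_id.add_const _)
      · rw [Set.indicator_of_mem]
        rw [mem_closedBall_zero_iff]
        have h1 := mem_closedBall_zero_iff.1 (hER hx)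
        have h2 : ‖(t * s) • v‖ ≤ ‖v‖ := by
          rw [norm_smul, norm_mul, Real.norm_of_nonneg ht.1.le, Real.norm_eq_abs]
          have : t * |s| ≤ 1 := mul_le_one₀ ht.2 (abs_nonneg s) hs
          nlinarith [norm_nonneg v]
        exact (norm_add_le _ _).trans (by linarith)
    calc ∫⁻ x in E, ‖fderiv ℝ g (x + (t * s) • v)‖ₑ
        ≤ ∫⁻ x in E, (l + ‖fderiv ℝ g (x + (t * s) • v)‖ₑ ^ n / (l : ℝ≥0∞) ^ (n - 1)) :=
          lintegral_mono fun x => ENNReal.le_add_pow_div hn _ hl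
      _ = l * volume E + (∫⁻ x in E, ‖fderiv ℝ g (x + (t * s) • v)‖ₑ ^ n)
            / (l : ℝ≥0∞) ^ (n - 1) := by
          rw [lintegral_add_left measurable_const, setLIntegral_const]
          simp only [div_eq_mul_inv]
          rw [lintegral_mul_const' _ _ (by simp [hl])]
      _ ≤ _ := by gcongr
  calc ∫⁻ x in E, ‖g (x + s • v) - g x‖ₑ
      ≤ ∫⁻ x in E, ‖s‖ₑ * ‖v‖ₑ *
          ∫⁻ t in Set.Ioc (0 : ℝ) 1, ‖fderiv ℝ g (x + (t * s) • v)‖ₑ :=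
        lintegral_mono fun x => enorm_add_smul_sub_le hg x v s
    _ = ‖s‖ₑ * ‖v‖ₑ * ∫⁻ t in Set.Ioc (0 : ℝ) 1,
          ∫⁻ x in E, ‖fderiv ℝ g (x + (t * s) • v)‖ₑ := by
        rw [lintegral_const_mul' _ _ (by finiteness), lintegral_lintegral_swap]
        refine Continuous.aemeasurable ?_ 
        exact (hcont.comp (by fun_prop)).enorm
    _ ≤ ‖s‖ₑ * ‖v‖ₑ * ∫⁻ t in Set.Ioc (0 : ℝ) 1, (l * volume E + I / (l : ℝ≥0∞) ^ (n - 1)) := by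
        gcongr 1
        exact setLIntegral_mono measurable_const hslice
    _ = _ := by simp

namespace IsDeltaMonotone

variable {n : ℕ} {δ : ℝ} {f : EuclideanSpace ℝ (Fin n) → EuclideanSpace ℝ (Fin n)}

/-- A uniform bound for the integrals of the difference quotients of `f` over sets `E`. The free
parameter `l` makes the right-hand side small when `E` is small. -/
theorem exists_setLIntegral_enorm_sub_le (hn : 2 ≤ n) (hf : IsDeltaMonotone δ f)
    (R : ℝ) (v : EuclideanSpace ℝ (Fin n)) :
    ∃ C : ℝ≥0∞, C ≠ ⊤ ∧ ∀ l : ℝ≥0, l ≠ 0 → ∀ s : ℝ, |s| ≤ 1 → ∀ E ⊆ Metric.closedBall 0 R,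
      ∫⁻ x in E, ‖f (x + s • v) - f x‖ₑ
        ≤ ‖s‖ₑ * ‖v‖ₑ * (l * volume E + C / (l : ℝ≥0∞) ^ (n - 1)) := by
  have hc := hf.continuous hn
  obtain ⟨g, hg, hgs, hgf, hgb⟩ := hf.exists_smooth_approx hc
  obtain ⟨C, hC, hE⟩ := exists_energy_le hn hf.1
  obtain ⟨M, hM⟩ := hgb (R + ‖v‖)
  refine ⟨C * volume (Metric.closedBall (0 : EuclideanSpace ℝ (Fin n)) M),
    ENNReal.mul_ne_top hC measure_closedBall_lt_top.ne, fun l hl s hs E hER => ?_⟩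
  refine lintegral_le_of_tendsto_of_forall_le (F := fun k x => ‖g k (x + s • v) - g k x‖ₑ)
    (fun k => ?_) (Filter.Eventually.of_forall fun x => ((hgf _).sub (hgf _)).enorm) fun k => ?_
  · have := (hgs k).continuous
    exact Continuous.measurable (by fun_prop)
  · refine (setLIntegral_enorm_add_smul_sub_le (by omega) (hgs k) v hs hl hER).trans ?_
    gcongr
    refine (hE (g k) (hg k) ((hgs k).differentiable one_ne_zero) _
      Metric.isClosed_closedBall.measurableSet).trans ?_
    gcongr
    rintro _ ⟨x, hx, rfl⟩
    exact mem_closedBall_zero_iff.2 (hM k x hx)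

theorem exists_setLIntegral_enorm_quotient_le (hn : 2 ≤ n) (hf : IsDeltaMonotone δ f)
    (R : ℝ) (v : EuclideanSpace ℝ (Fin n)) :
    ∃ C : ℝ≥0∞, C ≠ ⊤ ∧ ∀ l : ℝ≥0, l ≠ 0 → ∀ s : ℝ, |s| ≤ 1 → s ≠ 0 →
      ∀ E ⊆ Metric.closedBall 0 R, ∫⁻ x in E, ‖s⁻¹ • (f (x + s • v) - f x)‖ₑ
        ≤ ‖v‖ₑ * (l * volume E + C / (l : ℝ≥0∞) ^ (n - 1)) := by
  obtain ⟨C, hC, h⟩ := hf.exists_setLIntegral_enorm_sub_le hn R v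
  refine ⟨C, hC, fun l hl s hs hs0 E hE => ?_⟩
  have hs' : ‖s‖ₑ ≠ 0 := by simpa using hs0
  simp only [enorm_smul, enorm_inv hs0]
  rw [lintegral_const_mul' _ _ (by simp [hs0])]
  refine (mul_le_mul_right (h l hl s hs E hE) _).trans_eq ?_
  rw [← mul_assoc, ← mul_assoc, ENNReal.inv_mul_cancel hs' (by finiteness), one_mul]

end IsDeltaMonotone

/-! ### Absolute continuity and the weak derivative -/

namespace IsDeltaMonotone

variable {n : ℕ} {δ : ℝ} {f : EuclideanSpace ℝ (Fin n) → EuclideanSpace ℝ (Fin n)}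

theorem comp_add_right (hf : IsDeltaMonotone δ f) (a : EuclideanSpace ℝ (Fin n)) :
    IsDeltaMonotone δ (fun x => f (x + a)) :=
  ⟨hf.1, hf.2.1, fun x y => by simpa using hf.2.2 (x + a) (y + a)⟩

theorem tendsto_quotient {x : EuclideanSpace ℝ (Fin n)} (hx : DifferentiableAt ℝ f x)
    (v : EuclideanSpace ℝ (Fin n)) {u : ℕ → ℝ}
    (hu : Filter.Tendsto u Filter.atTop (nhdsWithin 0 {0}ᶜ)) :
    Filter.Tendsto (fun k => (u k)⁻¹ • (f (x + u k • v) - f x)) Filter.atTop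
      (nhds (fderiv ℝ f x v)) := by
  have h : HasDerivAt (fun s : ℝ => f (x + s • v)) (fderiv ℝ f x v) 0 :=
    hx.hasFDerivAt.hasLineDerivAt v
  have := (hasDerivAt_iff_tendsto_slope_zero.1 h).comp hu
  simpa [Function.comp_def] using this

theorem setLIntegral_enorm_fderiv_apply_lt_top (hn : 2 ≤ n) (hf : IsDeltaMonotone δ f) (R : ℝ)
    (v : EuclideanSpace ℝ (Fin n)) :
    ∫⁻ x in Metric.closedBall 0 R, ‖fderiv ℝ f x v‖ₑ < ⊤ := by
  have hc := hf.continuous hn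
  obtain ⟨C, hC, h⟩ := hf.exists_setLIntegral_enorm_quotient_le hn R v
  set B := Metric.closedBall (0 : EuclideanSpace ℝ (Fin n)) R with hB
  set u : ℕ → ℝ := fun k => 1 / ((k : ℝ) + 1) with hu
  have hu0 : ∀ k, 0 < u k := fun k => by simp only [hu]; positivity
  have hu1 : ∀ k, |u k| ≤ 1 := fun k => by
    rw [abs_of_pos (hu0 k)]
    simp only [hu]
    rw [div_le_one (by positivity)]; simp
  have hut : Filter.Tendsto u Filter.atTop (nhdsWithin 0 {0}ᶜ) :=
    tendsto_nhdsWithin_iff.2 ⟨tendsto_one_div_add_atTop_nhds_zero_nat,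
      Filter.Eventually.of_forall fun k => (hu0 k).ne'⟩
  refine (lintegral_le_of_tendsto_of_forall_le (C := ‖v‖ₑ * ((1 : ℝ≥0) * volume B
    + C / ((1 : ℝ≥0) : ℝ≥0∞) ^ (n - 1))) (F := fun k x => ‖(u k)⁻¹ • (f (x + u k • v) - f x)‖ₑ)
    (fun k => Continuous.measurable (by fun_prop)) ?_
    fun k => h 1 one_ne_zero (u k) (hu1 k) (hu0 k).ne' B subset_rfl).trans_lt ?_
  · filter_upwards [ae_restrict_of_ae (hf.ae_differentiableAt hc)] with x hx
    exact (tendsto_quotient hx v hut).enorm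
  · have : volume B ≠ ⊤ := measure_closedBall_lt_top.ne
    simp only [ENNReal.coe_one, one_pow, div_one, one_mul]
    finiteness

theorem locallyIntegrable_fderiv (hn : 2 ≤ n) (hf : IsDeltaMonotone δ f) :
    LocallyIntegrable (fderiv ℝ f) volume := by
  have hc := hf.continuous hn
  obtain ⟨C, hC, hop⟩ := exists_opNorm_le hn hf.1
  obtain ⟨v, hv, -, -⟩ := exists_unit_orthogonal hn 0 0
  rw [locallyIntegrable_iff]
  intro K hK
  obtain ⟨R, hR⟩ := hK.isBounded.subset_closedBall 0
  refine IntegrableOn.mono_set ?_ hR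
  refine ⟨(measurable_fderiv ℝ f).aestronglyMeasurable, ?_⟩
  refine lt_of_le_of_lt ?_ (ENNReal.mul_lt_top (ENNReal.ofReal_lt_top (r := C))
    (hf.setLIntegral_enorm_fderiv_apply_lt_top hn R v))
  rw [← lintegral_const_mul' _ _ ENNReal.ofReal_ne_top]
  refine lintegral_mono_ae ?_
  filter_upwards [ae_restrict_of_ae (hf.ae_differentiableAt hc)] with x hx
  have := hop _ (hf.hasFDerivAt hx.hasFDerivAt) v
  rw [hv, mul_one] at this
  rw [← ofReal_norm, ← ofReal_norm, ← ENNReal.ofReal_mul hC.le]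
  exact ENNReal.ofReal_le_ofReal this

/-- The difference quotients of `f` along a null sequence are uniformly integrable on balls, so by
Vitali's theorem they converge to the pointwise derivative in `L¹`. -/
theorem tendsto_eLpNorm_quotient (hn : 2 ≤ n) (hf : IsDeltaMonotone δ f) (R : ℝ)
    (v : EuclideanSpace ℝ (Fin n)) {u : ℕ → ℝ}
    (hu : Filter.Tendsto u Filter.atTop (nhdsWithin 0 {0}ᶜ)) (hu1 : ∀ k, |u k| ≤ 1)
    (hu0 : ∀ k, u k ≠ 0) :
    Filter.Tendsto (fun k => eLpNorm ((fun x => (u k)⁻¹ • (f (x + u k • v) - f x))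
      - fun x => fderiv ℝ f x v) 1 (volume.restrict (Metric.closedBall 0 R)))
      Filter.atTop (nhds 0) := by
  have hc := hf.continuous hn
  set B := Metric.closedBall (0 : EuclideanSpace ℝ (Fin n)) R with hB
  have hBm : MeasurableSet B := Metric.isClosed_closedBall.measurableSet
  have : IsFiniteMeasure (volume.restrict B) :=
    isFiniteMeasure_restrict.2 measure_closedBall_lt_top.ne
  have hmeas : ∀ k, Continuous (fun x => (u k)⁻¹ • (f (x + u k • v) - f x)) := fun k => by
    fun_prop
  refine tendsto_Lp_finite_of_tendsto_ae le_rfl ENNReal.one_ne_top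
    (fun k => (hmeas k).aestronglyMeasurable) ?_ ?_ ?_
  · rw [memLp_one_iff_integrable]
    exact ⟨((measurable_fderiv ℝ f).apply_continuousLinearMap v).aestronglyMeasurable,
      hf.setLIntegral_enorm_fderiv_apply_lt_top hn R v⟩
  · obtain ⟨C, hC, h⟩ := hf.exists_setLIntegral_enorm_quotient_le hn R v
    intro ε hε
    lift C to ℝ≥0 using hC
    lift ε to ℝ≥0 using hε.le
    have hε' : 0 < ε := hε
    obtain ⟨V, hV0, hV⟩ : ∃ V : ℝ≥0, 0 < V ∧ ‖v‖ₑ ≤ V :=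
      ⟨‖v‖₊ + 1, by positivity, by rw [enorm_eq_nnnorm]; exact_mod_cast le_self_add⟩
    -- `l` makes the term with `C` at most `ε / 2`, then `η` does this for the other term.
    obtain ⟨l, hl⟩ : ∃ l : ℝ≥0, l = 1 + 2 * V * C / ε := ⟨_, rfl⟩
    have hl0 : 0 < l := by rw [hl]; positivity
    have hl1 : 1 ≤ l := hl ▸ le_self_add
    obtain ⟨η, hη⟩ : ∃ η : ℝ≥0, η = ε / (2 * V * l) := ⟨_, rfl⟩
    refine ⟨η, by rw [hη]; positivity, fun k s hs hsη => ?_⟩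
    rw [Measure.restrict_apply hs, ENNReal.ofReal_coe_nnreal] at hsη
    rw [eLpNorm_indicator_eq_eLpNorm_restrict hs, Measure.restrict_restrict hs,
      eLpNorm_one_eq_lintegral_enorm, ENNReal.ofReal_coe_nnreal]
    refine (h l hl0.ne' (u k) (hu1 k) (hu0 k) (s ∩ B) Set.inter_subset_right).trans ?_
    have hfin : V * (l * η + C / l ^ (n - 1)) ≤ ε := by
      have e1 : V * (l * η) = ε / 2 := by rw [hη]; field_simp
      have e2 : C / l ^ (n - 1) ≤ C / l := by
        gcongr
        exact le_self_pow₀ hl1 (by omega)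
      have e3 : V * (C / l) ≤ ε / 2 := by
        rw [← mul_div_assoc, div_le_div_iff₀ hl0 two_pos]
        calc V * C * 2 = ε * (2 * V * C / ε) := by field_simp
          _ ≤ ε * l := by rw [hl]; gcongr; exact le_add_self
      calc _ ≤ V * (l * η + C / l) := by gcongr
        _ ≤ ε / 2 + ε / 2 := by rw [mul_add, e1]; gcongr
        _ = ε := add_halves ε
    calc _ ≤ (V : ℝ≥0∞) * (l * η + C / (l : ℝ≥0∞) ^ (n - 1)) := by
          gcongr
      _ = ((V * (l * η + C / l ^ (n - 1)) : ℝ≥0) : ℝ≥0∞) := by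
          rw [ENNReal.coe_mul V, ENNReal.coe_add (l * η), ENNReal.coe_mul l,
            ENNReal.coe_div (by positivity), ENNReal.coe_pow]
      _ ≤ ε := by exact_mod_cast hfin
  · filter_upwards [ae_restrict_of_ae (hf.ae_differentiableAt hc)] with x hx
    exact tendsto_quotient hx v hu

/-- Differentiation under the integral sign along translations. -/
theorem hasDerivAt_integral_smul (hn : 2 ≤ n) (hf : IsDeltaMonotone δ f)
    {w : EuclideanSpace ℝ (Fin n) → ℝ} {M R : ℝ} (hw : AEStronglyMeasurable w volume)
    (hwM : ∀ x, ‖w x‖ ≤ M) (hwR : ∀ x ∉ Metric.closedBall 0 R, w x = 0)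
    (v : EuclideanSpace ℝ (Fin n)) (s : ℝ) :
    HasDerivAt (fun s : ℝ => ∫ x, w x • f (x + s • v))
      (∫ x, w x • fderiv ℝ f (x + s • v) v) s := by
  have hc := hf.continuous hn
  set B := Metric.closedBall (0 : EuclideanSpace ℝ (Fin n)) R with hB
  have hBm : MeasurableSet B := Metric.isClosed_closedBall.measurableSet
  have hM : 0 ≤ M := (norm_nonneg _).trans (hwM 0)
  have hres : ∀ F : EuclideanSpace ℝ (Fin n) → EuclideanSpace ℝ (Fin n),
      ∫ x, w x • F x = ∫ x in B, w x • F x := fun F =>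
    (setIntegral_eq_integral_of_forall_compl_eq_zero fun x hx => by rw [hwR x hx, zero_smul]).symm
  set f' := fun x => f (x + s • v) with hf'
  have hmono : IsDeltaMonotone δ f' := hf.comp_add_right _
  have hfd : ∀ x, fderiv ℝ f (x + s • v) = fderiv ℝ f' x := fun x =>
    (fderiv_comp_add_right (s • v)).symm
  have hc' : Continuous f' := hmono.continuous hn
  have hintc : ∀ g : EuclideanSpace ℝ (Fin n) → EuclideanSpace ℝ (Fin n), Continuous g →
      IntegrableOn (fun x => w x • g x) B := fun g hg =>
    (hg.continuousOn.integrableOn_compact (isCompact_closedBall _ _)).bdd_smul M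
      hw.restrict (Filter.Eventually.of_forall hwM)
  simp only [hfd]
  rw [hasDerivAt_iff_tendsto_slope_zero]
  refine Filter.tendsto_of_seq_tendsto fun u hu => ?_
  -- Only the tail of the sequence, where `0 < |u k| ≤ 1`, matters.
  have hev : ∀ᶠ k in Filter.atTop, |u k| ≤ 1 ∧ u k ≠ 0 := by
    have h1 := (tendsto_nhdsWithin_iff.1 hu).1.abs
    rw [abs_zero] at h1
    filter_upwards [h1.eventually_le_const one_pos, (tendsto_nhdsWithin_iff.1 hu).2] with k h1 h2
    exact ⟨h1, h2⟩
  obtain ⟨N, hN⟩ := Filter.eventually_atTop.1 hev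
  rw [← Filter.tendsto_add_atTop_iff_nat N]
  have hu' : Filter.Tendsto (fun k => u (k + N)) Filter.atTop (nhdsWithin 0 {0}ᶜ) :=
    hu.comp (Filter.tendsto_add_atTop_nat N)
  have hL := hmono.tendsto_eLpNorm_quotient hn R v hu' (fun k => (hN _ (by omega)).1)
    (fun k => (hN _ (by omega)).2)
  have hrw : ∀ k, (u (k + N))⁻¹ • ((∫ x, w x • f (x + (s + u (k + N)) • v))
      - ∫ x, w x • f (x + s • v))
      = ∫ x in B, w x • ((u (k + N))⁻¹ • (f' (x + u (k + N) • v) - f' x)) := by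
    intro k
    rw [hres (fun x => f (x + (s + u (k + N)) • v)), hres (fun x => f (x + s • v)),
      ← integral_sub (hintc _ (by fun_prop)) (hintc _ (by fun_prop)), ← integral_smul]
    refine integral_congr_ae (Filter.Eventually.of_forall fun x => ?_)
    have : x + u (k + N) • v + s • v = x + (s + u (k + N)) • v := by module
    simp only [hf', this]
    rw [← smul_sub, smul_comm]
  simp only [Function.comp_def, hrw]
  rw [hres (fun x => fderiv ℝ f' x v)]
  refine tendsto_integral_of_L1' _ ?_ (Filter.Eventually.of_forall fun k =>
    hintc _ (by fun_prop)) ?_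
  · have hi : IntegrableOn (fun x => fderiv ℝ f' x v) B :=
      ⟨((measurable_fderiv ℝ f').apply_continuousLinearMap v).aestronglyMeasurable,
        hmono.setLIntegral_enorm_fderiv_apply_lt_top hn R v⟩
    exact (hi.bdd_smul M hw.restrict (Filter.Eventually.of_forall hwM)).aestronglyMeasurable
  · refine tendsto_of_tendsto_of_tendsto_of_le_of_le tendsto_const_nhds
      (g := fun _ => 0) ((ENNReal.Tendsto.const_mul hL (Or.inr (ENNReal.ofReal_ne_top (r := M)))).trans
        (by rw [mul_zero])) (fun k => zero_le) fun k => ?_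
    simp only [eLpNorm_one_eq_lintegral_enorm]
    rw [← lintegral_const_mul' _ _ ENNReal.ofReal_ne_top]
    refine lintegral_mono fun x => ?_
    simp only [Pi.sub_apply]
    rw [← smul_sub, enorm_smul]
    gcongr
    rw [← ofReal_norm]
    exact ENNReal.ofReal_le_ofReal (hwM x)

theorem hasWeakDerivative_fderiv (hn : 2 ≤ n) (hf : IsDeltaMonotone δ f) :
    HasWeakDerivative f (fderiv ℝ f) := by
  have hc := hf.continuous hn
  refine ⟨hc.locallyIntegrable, hf.locallyIntegrable_fderiv hn, fun φ hφ hφc v => ?_⟩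
  obtain ⟨R, hR⟩ := hφc.isCompact.isBounded.subset_closedBall 0
  obtain ⟨M, hM⟩ := hφc.exists_bound_of_continuous hφ.continuous
  have h1 := hf.hasDerivAt_integral_smul hn (M := M) (R := R)
    hφ.continuous.aestronglyMeasurable hM
    (fun x hx => image_eq_zero_of_notMem_tsupport fun h => hx (hR h)) v 0
  simp only [zero_smul, add_zero] at h1
  have h2 : HasDerivAt (fun s : ℝ => ∫ x, φ x • f (x + s • v))
      (- ∫ x, (fderiv ℝ φ x v) • f x) 0 := by
    have hshift : ∀ s : ℝ, ∫ x, φ x • f (x + s • v) = ∫ x, φ (x - s • v) • f x := fun s => by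
      rw [← integral_add_right_eq_self (fun x => φ (x - s • v) • f x) (s • v)]
      simp
    simp only [hshift]
    have hd : ∀ x, DifferentiableAt ℝ φ x := fun x => (hφ.differentiable (by simp)) x
    have hφ' : Continuous (fderiv ℝ φ) := hφ.continuous_fderiv (by simp)
    obtain ⟨M', hM'⟩ := (hφc.fderiv ℝ).exists_bound_of_continuous hφ'
    set B := Metric.closedBall (0 : EuclideanSpace ℝ (Fin n)) (R + ‖v‖) with hB
    have hBm : MeasurableSet B := Metric.isClosed_closedBall.measurableSet
    have hbound : IntegrableOn (fun x => M' * ‖v‖ * ‖f x‖) B :=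
      Continuous.continuousOn (by fun_prop) |>.integrableOn_compact (isCompact_closedBall _ _)
    have key := (hasDerivAt_integral_of_dominated_loc_of_deriv_le (μ := volume) (x₀ := (0 : ℝ))
      (F := fun s x => φ (x - s • v) • f x)
      (F' := fun s x => (-(fderiv ℝ φ (x - s • v) v)) • f x)
      (bound := B.indicator fun x => M' * ‖v‖ * ‖f x‖) (Metric.ball_mem_nhds 0 one_pos)
      (Filter.Eventually.of_forall fun s => ?_) ?_ ?_ ?_ ?_ ?_).2
    · simpa [integral_neg] using key
    · have := hφ.continuous
      exact Continuous.aestronglyMeasurable (by fun_prop)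
    · simp only [zero_smul, sub_zero]
      exact (hφ.continuous.smul hc).integrable_of_hasCompactSupport hφc.smul_right
    · exact Continuous.aestronglyMeasurable (by fun_prop)
    · refine Filter.Eventually.of_forall fun x s hs => ?_
      rw [mem_ball_zero_iff, Real.norm_eq_abs] at hs
      by_cases hx : x ∈ B
      · rw [Set.indicator_of_mem hx, norm_smul, norm_neg]
        gcongr
        exact (ContinuousLinearMap.le_opNorm _ _).trans (by gcongr; exact hM' _)
      · have hx' : x - s • v ∉ tsupport (fderiv ℝ φ) := fun hmem => hx <| by
          have k1 := mem_closedBall_zero_iff.1 (hR (tsupport_fderiv_subset ℝ hmem))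
          have k2 := norm_add_le (x - s • v) (s • v)
          rw [sub_add_cancel, norm_smul, Real.norm_eq_abs] at k2
          rw [mem_closedBall_zero_iff]
          nlinarith [norm_nonneg v]
        rw [Set.indicator_of_notMem hx, image_eq_zero_of_notMem_tsupport hx']
        simp
    · exact (integrable_indicator_iff hBm).2 hbound
    · refine Filter.Eventually.of_forall fun x s hs => ?_
      have h3 : HasDerivAt (fun s : ℝ => x - s • v) (-v) s := by
        simpa using ((hasDerivAt_id s).smul_const v).const_sub x
      have h4 := (hd (x - s • v)).hasFDerivAt.comp_hasDerivAt s h3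
      rw [map_neg] at h4
      exact h4.smul_const (f x)
  rw [h1.unique h2, neg_neg]

end IsDeltaMonotone

/-! ### Integrals of the derivative over boxes -/

namespace IsDeltaMonotone

variable {n : ℕ} {δ : ℝ} {f : EuclideanSpace ℝ (Fin n) → EuclideanSpace ℝ (Fin n)}

theorem integrableOn_fderiv (hn : 2 ≤ n) (hf : IsDeltaMonotone δ f)
    {R : Set (EuclideanSpace ℝ (Fin n))} (hR : Bornology.IsBounded R) :
    IntegrableOn (fderiv ℝ f) R := by
  obtain ⟨r, hr⟩ := hR.subset_closedBall 0
  exact ((hf.locallyIntegrable_fderiv hn).integrableOn_isCompact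
    (isCompact_closedBall 0 r)).mono_set hr

/-- The mean value theorem for `s ↦ ∫ x in S, ⟪f (x + s • e), e⟫`. It replaces integration along
lines parallel to `e`. -/
theorem exists_mul_setIntegral_fderiv_eq (hn : 2 ≤ n) (hf : IsDeltaMonotone δ f)
    {S : Set (EuclideanSpace ℝ (Fin n))} (hS : MeasurableSet S) (hSb : Bornology.IsBounded S)
    (e : EuclideanSpace ℝ (Fin n)) {T : ℝ} (hT : 0 < T) :
    ∃ s ∈ Set.Ioo 0 T, T * ∫ x in (fun x => x + s • e) '' S, inner ℝ (fderiv ℝ f x e) e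
      = ∫ x in S, inner ℝ (f (x + T • e) - f x) e := by
  have hc := hf.continuous hn
  obtain ⟨R, hR⟩ := hSb.subset_closedBall 0
  have hder : ∀ s : ℝ, HasDerivAt (fun s : ℝ => ∫ x in S, f (x + s • e))
      (∫ x in S, fderiv ℝ f (x + s • e) e) s := by
    intro s
    have := hf.hasDerivAt_integral_smul hn (w := S.indicator 1) (M := 1) (R := R)
      ((measurable_one.indicator hS).aestronglyMeasurable)
      (fun x => (norm_indicator_le_norm_self _ _).trans (by simp))
      (fun x hx => Set.indicator_of_notMem (fun h => hx (hR h)) _) e s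
    have hrw : ∀ F : EuclideanSpace ℝ (Fin n) → EuclideanSpace ℝ (Fin n),
        ∫ x, S.indicator (1 : EuclideanSpace ℝ (Fin n) → ℝ) x • F x = ∫ x in S, F x := by
      intro F
      rw [← integral_indicator hS]
      refine integral_congr_ae (Filter.Eventually.of_forall fun x => ?_)
      by_cases hx : x ∈ S <;> simp [hx]
    simp only [hrw] at this
    exact this
  have hder' : ∀ s : ℝ, HasDerivAt (fun s : ℝ => inner ℝ (∫ x in S, f (x + s • e)) e)
      (inner ℝ (∫ x in S, fderiv ℝ f (x + s • e) e) e) s := fun s => by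
    simpa using (hder s).inner ℝ (hasDerivAt_const s e)
  have hint : ∀ s : ℝ, IntegrableOn (fun x => f (x + s • e)) S := fun s =>
    (Continuous.continuousOn (by fun_prop) |>.integrableOn_compact
      (isCompact_closedBall 0 R)).mono_set hR
  have hmp : ∀ s : ℝ, MeasurePreserving (fun x : EuclideanSpace ℝ (Fin n) => x + s • e) :=
    fun s => measurePreserving_add_right volume (s • e)
  have hme : ∀ s : ℝ, MeasurableEmbedding (fun x : EuclideanSpace ℝ (Fin n) => x + s • e) :=
    fun s => measurableEmbedding_addRight _
  have hintD : ∀ s : ℝ, IntegrableOn (fun x => fderiv ℝ f (x + s • e) e) S := fun s => by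
    have hb : Bornology.IsBounded ((fun x => x + s • e) '' S) :=
      (IsometryEquiv.addRight (s • e)).isometry.lipschitz.isBounded_image hSb
    have h1 : IntegrableOn (fun x => fderiv ℝ f x e) ((fun x => x + s • e) '' S) :=
      (hf.integrableOn_fderiv hn hb).apply_continuousLinearMap e
    exact ((hmp s).integrableOn_image (hme s)).1 h1
  obtain ⟨s, hs, hs'⟩ := exists_hasDerivAt_eq_slope
    (fun s : ℝ => inner ℝ (∫ x in S, f (x + s • e)) e)
    (fun s : ℝ => inner ℝ (∫ x in S, fderiv ℝ f (x + s • e) e) e) hT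
    (fun s _ => (hder' s).continuousAt.continuousWithinAt) (fun s _ => hder' s)
  refine ⟨s, hs, ?_⟩
  rw [(hmp s).setIntegral_image_emb (hme s)]
  have e1 : ∫ x in S, inner ℝ (fderiv ℝ f (x + s • e) e) e
      = inner ℝ (∫ x in S, fderiv ℝ f (x + s • e) e) e := by
    rw [real_inner_comm, ← integral_inner (hintD s)]
    simp only [real_inner_comm]
  have e2 : ∫ x in S, inner ℝ (f (x + T • e) - f x) e
      = inner ℝ (∫ x in S, f (x + T • e)) e - inner ℝ (∫ x in S, f (x + (0 : ℝ) • e)) e := by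
    have h0 : IntegrableOn f S := by simpa using hint 0
    have h1 : IntegrableOn (fun x => f (x + T • e) - f x) S := (hint T).sub h0
    simp only [zero_smul, add_zero]
    rw [← inner_sub_left, ← integral_sub (hint T) h0, real_inner_comm, ← integral_inner h1]
    simp only [real_inner_comm]
  rw [e1, e2, hs', sub_zero]
  field_simp

/-- Lower bound for the integral of `‖Df‖` over a set `R` that contains the translates `S + s • e`,
`0 < s < T`. -/
theorem le_mul_setIntegral_norm_fderiv (hn : 2 ≤ n) (hf : IsDeltaMonotone δ f)
    {R S : Set (EuclideanSpace ℝ (Fin n))} (hRb : Bornology.IsBounded R) (hS : MeasurableSet S)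
    (hSb : Bornology.IsBounded S) {e : EuclideanSpace ℝ (Fin n)} (he : ‖e‖ = 1) {T L : ℝ}
    (hT : 0 < T) (hSR : ∀ s ∈ Set.Ioo 0 T, (fun x => x + s • e) '' S ⊆ R)
    (hL : ∀ x ∈ S, L ≤ inner ℝ (f (x + T • e) - f x) e) :
    L * volume.real S ≤ T * ∫ x in R, ‖fderiv ℝ f x‖ := by
  have hc := hf.continuous hn
  obtain ⟨s, hs, heq⟩ := hf.exists_mul_setIntegral_fderiv_eq hn hS hSb e hT
  obtain ⟨r, hr⟩ := hSb.subset_closedBall 0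
  have hDR : IntegrableOn (fun x => ‖fderiv ℝ f x‖) R := (hf.integrableOn_fderiv hn hRb).norm
  have hle : ∀ x, inner ℝ (fderiv ℝ f x e) e ≤ ‖fderiv ℝ f x‖ := fun x => by
    refine (real_inner_le_norm _ _).trans ?_
    rw [he, mul_one]
    simpa [he] using (fderiv ℝ f x).le_opNorm e
  calc L * volume.real S = ∫ x in S, L := by simp [mul_comm]
    _ ≤ ∫ x in S, inner ℝ (f (x + T • e) - f x) e := by
        refine setIntegral_mono_on (integrableOn_const hSb.measure_lt_top.ne) ?_ hS hL
        exact (Continuous.continuousOn (by fun_prop) |>.integrableOn_compact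
          (isCompact_closedBall 0 r)).mono_set hr
    _ = _ := heq.symm
    _ ≤ T * ∫ x in (fun x => x + s • e) '' S, ‖fderiv ℝ f x‖ := by
        refine mul_le_mul_of_nonneg_left ?_ hT.le
        exact integral_mono ((hf.integrableOn_fderiv hn
          (hRb.subset (hSR s hs))).apply_continuousLinearMap e |>.inner_const e)
          (hDR.mono_set (hSR s hs)) hle
    _ ≤ _ := mul_le_mul_of_nonneg_left (setIntegral_mono_set hDR
          (Filter.Eventually.of_forall fun x => norm_nonneg _) (hSR s hs).eventuallyLE) hT.le

/-- Upper bound for the integral of `‖Df‖` over a set `R` contained in the translates `S + s • e`,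
`0 < s < T`, by the pointwise estimate `‖Df‖ ≤ C / δ * ⟪Df e, e⟫`. -/
theorem mul_setIntegral_norm_fderiv_le (hn : 2 ≤ n) (hf : IsDeltaMonotone δ f) {C : ℝ}
    (hC : 0 < C) (hop : ∀ A : EuclideanSpace ℝ (Fin n) →L[ℝ] EuclideanSpace ℝ (Fin n),
      IsDeltaMonotone δ A → ∀ v, ‖A‖ * ‖v‖ ≤ C * ‖A v‖)
    {R S : Set (EuclideanSpace ℝ (Fin n))} (hS : MeasurableSet S)
    (hSb : Bornology.IsBounded S) {e : EuclideanSpace ℝ (Fin n)} (he : ‖e‖ = 1) {T L : ℝ}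
    (hT : 0 < T) (hSR : ∀ s ∈ Set.Ioo 0 T, R ⊆ (fun x => x + s • e) '' S)
    (hL : ∀ x ∈ S, inner ℝ (f (x + T • e) - f x) e ≤ L) :
    T * ∫ x in R, ‖fderiv ℝ f x‖ ≤ C / δ * (L * volume.real S) := by
  have hc := hf.continuous hn
  have h0 := hf.1
  obtain ⟨s, hs, heq⟩ := hf.exists_mul_setIntegral_fderiv_eq hn hS hSb e hT
  obtain ⟨r, hr⟩ := hSb.subset_closedBall 0
  set S' := (fun x => x + s • e) '' S with hS'
  have hb : Bornology.IsBounded S' := (IsometryEquiv.addRight (s • e)).isometry.lipschitz.isBounded_image hSb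
  have hDS : IntegrableOn (fun x => ‖fderiv ℝ f x‖) S' := (hf.integrableOn_fderiv hn hb).norm
  have hle : ∀ᵐ x, ‖fderiv ℝ f x‖ ≤ C / δ * inner ℝ (fderiv ℝ f x e) e := by
    filter_upwards [hf.ae_differentiableAt hc] with x hx
    have hA := hf.hasFDerivAt hx.hasFDerivAt
    have h1 := hop _ hA e
    have h2 := hA.2.2 e 0
    rw [map_zero, sub_zero, sub_zero, he, mul_one] at h2
    rw [he, mul_one] at h1
    calc _ ≤ _ := h1
      _ = C / δ * (δ * ‖fderiv ℝ f x e‖) := by field_simp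
      _ ≤ _ := by gcongr
  calc T * ∫ x in R, ‖fderiv ℝ f x‖ ≤ T * ∫ x in S', ‖fderiv ℝ f x‖ :=
        mul_le_mul_of_nonneg_left (setIntegral_mono_set hDS
          (Filter.Eventually.of_forall fun x => norm_nonneg _) (hSR s hs).eventuallyLE) hT.le
    _ ≤ T * ∫ x in S', C / δ * inner ℝ (fderiv ℝ f x e) e := by
        refine mul_le_mul_of_nonneg_left ?_ hT.le
        exact integral_mono_ae hDS (((hf.integrableOn_fderiv hn hb).apply_continuousLinearMap e
          |>.inner_const e).const_mul _) (ae_restrict_of_ae hle)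
    _ = C / δ * ∫ x in S, inner ℝ (f (x + T • e) - f x) e := by
        rw [integral_const_mul, ← heq]; ring
    _ ≤ C / δ * ∫ x in S, L := by
        refine mul_le_mul_of_nonneg_left ?_ (by positivity)
        refine setIntegral_mono_on ?_ (integrableOn_const hSb.measure_lt_top.ne) hS hL
        exact (Continuous.continuousOn (by fun_prop) |>.integrableOn_compact
          (isCompact_closedBall 0 r)).mono_set hr
    _ = _ := by simp [mul_comm]

end IsDeltaMonotone

/-! ### Rectangular boxes -/

theorem IsometryEquiv.volume_image {n : ℕ}
    (g : EuclideanSpace ℝ (Fin n) ≃ᵢ EuclideanSpace ℝ (Fin n))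
    (s : Set (EuclideanSpace ℝ (Fin n))) : volume (g '' s) = volume s := by
  rw [← EuclideanSpace.euclideanHausdorffMeasure_eq_volume]
  exact g.isometry.euclideanHausdorffMeasure_image s

theorem IsometryEquiv.map_add_smul {n : ℕ}
    (g : EuclideanSpace ℝ (Fin n) ≃ᵢ EuclideanSpace ℝ (Fin n))
    (x v : EuclideanSpace ℝ (Fin n)) (t : ℝ) :
    g (x + t • v) = g x + t • g.toRealLinearIsometryEquiv v := by
  have h : ∀ y, g y = g.toRealLinearIsometryEquiv y + g 0 := fun y => by simp
  rw [h (x + t • v), h x, map_add, map_smul]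
  abel

/-- A box `R` contains the translates of one of its halves `S` by up to half of its longest side
`M • e`, and its union with the translate by `-M • e` plays the opposite role. -/
theorem IsRectangularBox.exists_slabs {n : ℕ} (hn : 2 ≤ n) {R : Set (EuclideanSpace ℝ (Fin n))}
    (hR : IsRectangularBox R) :
    IsClosed R ∧ Bornology.IsBounded R ∧ 0 < volume.real R ∧
    ∃ (e : EuclideanSpace ℝ (Fin n)) (M : ℝ) (S : Set (EuclideanSpace ℝ (Fin n))),
      ‖e‖ = 1 ∧ 0 < M ∧ M ≤ Metric.diam R ∧ Metric.diam R ≤ n * M ∧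
      IsClosed S ∧ S ⊆ R ∧ volume.real R ≤ 2 * volume.real S ∧
      (∀ s ∈ Set.Ioo 0 (M / 2), (fun x => x + s • e) '' S ⊆ R) ∧
      (∀ s ∈ Set.Ioo 0 M, R ⊆ (fun x => x + s • e) '' (R ∪ (fun x => x + (-M) • e) '' R)) := by
  obtain ⟨a, g, ha, rfl⟩ := hR
  set Q : Set (EuclideanSpace ℝ (Fin n)) := {x | ∀ i, 0 ≤ x i ∧ x i ≤ a i} with hQ
  have : Nonempty (Fin n) := ⟨⟨0, by omega⟩⟩
  obtain ⟨i, hi⟩ := Finite.exists_max a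
  set M := a i with hM
  have hM0 : 0 < M := ha i
  set b : EuclideanSpace ℝ (Fin n) := EuclideanSpace.single i 1 with hb
  have hcoord : ∀ (x : EuclideanSpace ℝ (Fin n)) (t : ℝ) (j : Fin n),
      (x + t • b) j = x j + if j = i then t else 0 := fun x t j => by
    simp [hb, PiLp.single_apply]
  set H : Set (EuclideanSpace ℝ (Fin n)) := Q ∩ {x | x i ≤ M / 2} with hH
  have hQc : IsClosed Q := by
    simp only [hQ, Set.ofPred_forall]
    refine isClosed_iInter fun j => ?_
    have hj : Continuous fun x : EuclideanSpace ℝ (Fin n) => x j := by fun_prop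
    exact (isClosed_le continuous_const hj).inter (isClosed_le hj continuous_const)
  have hHc : IsClosed H := hQc.inter (isClosed_le (by fun_prop) continuous_const)
  have hdist : ∀ x ∈ Q, ∀ y ∈ Q, dist x y ≤ n * M := by
    intro x hx y hy
    rw [EuclideanSpace.dist_eq, Real.sqrt_le_left (by positivity)]
    have hn' : (1 : ℝ) ≤ n := by exact_mod_cast (by omega : 1 ≤ n)
    calc ∑ j, dist (x j) (y j) ^ 2 ≤ ∑ _j : Fin n, M ^ 2 := by
          refine Finset.sum_le_sum fun j _ => ?_
          gcongr
          rw [Real.dist_eq, abs_le]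
          have := hx j; have := hy j; have := hi j
          constructor <;> linarith
      _ = n * M ^ 2 := by simp
      _ ≤ (n * M) ^ 2 := by nlinarith [sq_nonneg M]
  have hQb : Bornology.IsBounded Q := Metric.isBounded_iff.2 ⟨_, fun x hx y hy => hdist x hx y hy⟩
  have hgc : ∀ s, IsClosed s → IsClosed (g '' s) := fun s hs =>
    g.toHomeomorph.isClosedMap s hs
  have hRb : Bornology.IsBounded (g '' Q) := g.isometry.lipschitz.isBounded_image hQb
  have hreal : ∀ s, volume.real (g '' s) = volume.real s := fun s => by
    rw [measureReal_def, g.volume_image, measureReal_def]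
  have htrans : ∀ (s : Set (EuclideanSpace ℝ (Fin n))) (t : ℝ),
      (fun x => x + t • g.toRealLinearIsometryEquiv b) '' (g '' s)
        = g '' ((fun x => x + t • b) '' s) := by
    intro s t
    simp only [Set.image_image, g.map_add_smul]
  refine ⟨hgc _ hQc, hRb, ?_, g.toRealLinearIsometryEquiv b, M, g '' H, ?_, hM0, ?_, ?_,
    hgc _ hHc, Set.image_mono Set.inter_subset_left, ?_, ?_, ?_⟩
  · rw [hreal]
    refine ENNReal.toReal_pos (ne_of_gt ?_) hQb.measure_lt_top.ne
    have hopen : IsOpen {x : EuclideanSpace ℝ (Fin n) | ∀ j, 0 < x j ∧ x j < a j} := by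
      simp only [Set.ofPred_forall]
      refine isOpen_iInter_of_finite fun j => ?_
      have hj : Continuous fun x : EuclideanSpace ℝ (Fin n) => x j := by fun_prop
      exact (isOpen_lt continuous_const hj).inter (isOpen_lt hj continuous_const)
    refine (hopen.measure_pos volume ⟨WithLp.toLp 2 fun j => a j / 2, fun j => ?_⟩).trans_le
      (measure_mono fun x hx j => ⟨(hx j).1.le, (hx j).2.le⟩)
    exact ⟨half_pos (ha j), half_lt_self (ha j)⟩
  · rw [LinearIsometryEquiv.norm_map, hb]; simp
  · have h0 : (0 : EuclideanSpace ℝ (Fin n)) ∈ Q := fun j => ⟨le_rfl, (ha j).le⟩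
    have h1 : (0 : EuclideanSpace ℝ (Fin n)) + M • b ∈ Q := fun j => by
      rw [hcoord]
      split_ifs with h
      · subst h; simpa [hM] using (ha j).le
      · simpa using (ha j).le
    rw [g.diam_image]
    refine le_trans (le_of_eq ?_) (Metric.dist_le_diam_of_mem hQb h1 h0)
    simp [dist_eq_norm, norm_smul, hb, abs_of_pos hM0]
  · rw [g.diam_image]
    exact Metric.diam_le_of_forall_dist_le (by positivity) hdist
  · rw [hreal, hreal]
    have hcover : Q ⊆ H ∪ (fun x => x + (M / 2) • b) '' H := by
      intro x hx
      rcases le_total (x i) (M / 2) with h | h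
      · exact Or.inl ⟨hx, h⟩
      · refine Or.inr ⟨x + (-(M / 2)) • b, ⟨fun j => ?_, ?_⟩, by simp⟩
        · rw [hcoord]
          have := hx j
          split_ifs with hj
          · subst hj; constructor <;> linarith
          · simpa using this
        · change (x + (-(M / 2)) • b) i ≤ M / 2
          rw [hcoord, if_pos rfl]
          have := (hx i).2
          linarith
    have hHb : Bornology.IsBounded H := hQb.subset Set.inter_subset_left
    have hvol : volume.real ((fun x => x + (M / 2) • b) '' H) = volume.real H := by
      rw [measureReal_def, measureReal_def]
      exact congrArg _ ((IsometryEquiv.addRight ((M / 2) • b)).volume_image H)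
    have hb2 : Bornology.IsBounded ((fun x => x + (M / 2) • b) '' H) :=
      (IsometryEquiv.addRight ((M / 2) • b)).isometry.lipschitz.isBounded_image hHb
    calc volume.real Q ≤ volume.real (H ∪ (fun x => x + (M / 2) • b) '' H) :=
          measureReal_mono hcover (hHb.union hb2).measure_lt_top.ne
      _ ≤ _ := measureReal_union_le _ _
      _ = _ := by rw [hvol]; ring
  · intro s hs
    rw [htrans]
    refine Set.image_mono ?_
    rintro _ ⟨x, ⟨hx, hx'⟩, rfl⟩ j
    have := hx j
    rw [hcoord]
    split_ifs with hj
    · subst hj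
      have : x j ≤ M / 2 := hx'
      constructor <;> linarith [hs.1, hs.2]
    · simpa using this
  · intro s hs
    rw [htrans, ← Set.image_union, htrans]
    refine Set.image_mono ?_
    intro x hx
    rcases le_total s (x i) with h | h
    · refine ⟨x + (-s) • b, Or.inl fun j => ?_, by simp⟩
      have := hx j
      rw [hcoord]
      split_ifs with hj
      · subst hj; constructor <;> linarith [hs.1, hs.2]
      · simpa using this
    · refine ⟨x + (-s) • b, Or.inr ⟨x + (M - s) • b, fun j => ?_, ?_⟩, by simp⟩
      · have := hx j
        rw [hcoord]
        split_ifs with hj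
        · subst hj; constructor <;> linarith [hs.1, hs.2]
        · simpa using this
      · module

/-! ### The doubling property -/

/-- The integral of `‖Df‖` over a box `R` of diameter `d` is comparable to `|R| / d` times the
oscillation of `f` at scale `d` near `R`. -/
theorem exists_box_bounds {n : ℕ} (hn : 2 ≤ n) {δ : ℝ} (h0 : 0 < δ) :
    ∃ c C : ℝ, 0 < c ∧ 0 < C ∧ ∀ f : EuclideanSpace ℝ (Fin n) → EuclideanSpace ℝ (Fin n),
      IsDeltaMonotone δ f → ∀ R, IsRectangularBox R → ∀ x₀ ∈ R, ∀ v, ‖v‖ = Metric.diam R →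
        c * (‖f (x₀ + v) - f x₀‖ * volume.real R)
            ≤ Metric.diam R * ∫ x in R, ‖fderiv ℝ f x‖ ∧
          Metric.diam R * ∫ x in R, ‖fderiv ℝ f x‖
            ≤ C * (‖f (x₀ + v) - f x₀‖ * volume.real R) := by
  obtain ⟨Q, hQ0, hQ⟩ := exists_quasisymmetry hn h0 (4 * n)
  obtain ⟨P, hP0, hP⟩ := exists_opNorm_le hn h0
  have hn0 : (0 : ℝ) < n := by exact_mod_cast (by omega : 0 < n)
  refine ⟨δ / (2 * Q), n * (P / δ * (2 * Q * 2)), by positivity, by positivity,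
    fun f hf R hR x₀ hx₀ v hv => ?_⟩
  obtain ⟨hRc, hRb, hRv, e, M, S, he, hM, hMd, hdM, hSc, hSR, hvol, hin, hout⟩ :=
    hR.exists_slabs hn
  set d := Metric.diam R with hd
  set L := ‖f (x₀ + v) - f x₀‖ with hL
  set I := ∫ x in R, ‖fderiv ℝ f x‖ with hI
  have hI0 : 0 ≤ I := integral_nonneg fun x => norm_nonneg _
  have hn2 : (2 : ℝ) ≤ n := by exact_mod_cast hn
  have hdR : ∀ x ∈ R, ‖x - x₀‖ ≤ d := fun x hx => by
    rw [← dist_eq_norm]; exact Metric.dist_le_diam_of_mem hRb hx hx₀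
  constructor
  · have hlow : ∀ x ∈ S, δ / (2 * Q) * L ≤ inner ℝ (f (x + (M / 2) • e) - f x) e := by
      intro x hx
      have hxx : ‖x + (M / 2) • e - x‖ = M / 2 := by
        rw [add_sub_cancel_left, norm_smul, he, Real.norm_of_nonneg (by positivity), mul_one]
      have hx0 : ‖x₀ - x‖ ≤ d := by rw [norm_sub_rev]; exact hdR x (hSR hx)
      have q1 := hQ f hf x (x + (M / 2) • e) x₀ (by rw [hxx]; nlinarith)
      have q2 := hQ f hf x (x + (M / 2) • e) (x₀ + v) (by
        rw [hxx]
        have : ‖x₀ + v - x‖ ≤ ‖x₀ - x‖ + ‖v‖ := by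
          rw [add_sub_right_comm]; exact norm_add_le _ _
        rw [hv] at this
        linarith)
      have q3 := norm_sub_le_norm_sub_add_norm_sub (f (x₀ + v)) (f x) (f x₀)
      rw [norm_sub_rev (f x)] at q3
      have q4 := hf.2.2 (x + (M / 2) • e) x
      rw [hxx, add_sub_cancel_left, inner_smul_right] at q4
      have q5 : δ * ‖f (x + (M / 2) • e) - f x‖ ≤ inner ℝ (f (x + (M / 2) • e) - f x) e :=
        le_of_mul_le_mul_left (by linarith) (half_pos hM)
      calc δ / (2 * Q) * L ≤ δ / (2 * Q) * (2 * Q * ‖f (x + (M / 2) • e) - f x‖) := by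
            gcongr; linarith
        _ = δ * ‖f (x + (M / 2) • e) - f x‖ := by field_simp
        _ ≤ _ := q5
    have key := hf.le_mul_setIntegral_norm_fderiv hn hRb hSc.measurableSet (hRb.subset hSR) he
      (half_pos hM) hin hlow
    calc δ / (2 * Q) * (L * volume.real R) ≤ δ / (2 * Q) * (L * (2 * volume.real S)) := by
          gcongr
      _ = 2 * (δ / (2 * Q) * L * volume.real S) := by ring
      _ ≤ 2 * (M / 2 * I) := by gcongr
      _ = M * I := by ring
      _ ≤ d * I := by gcongr
  · set S' := R ∪ (fun x => x + (-M) • e) '' R with hS'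
    have htb : Bornology.IsBounded ((fun x => x + (-M) • e) '' R) :=
      (IsometryEquiv.addRight ((-M) • e)).isometry.lipschitz.isBounded_image hRb
    have htc : IsClosed ((fun x => x + (-M) • e) '' R) :=
      (Homeomorph.addRight ((-M) • e)).isClosedMap R hRc
    have hvol' : volume.real S' ≤ 2 * volume.real R := by
      refine (measureReal_union_le _ _).trans_eq ?_
      have : volume.real ((fun x => x + (-M) • e) '' R) = volume.real R := by
        rw [measureReal_def, measureReal_def]
        exact congrArg _ ((IsometryEquiv.addRight ((-M) • e)).volume_image R)
      rw [this]; ring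
    have hnear : ∀ x ∈ S', ‖x - x₀‖ ≤ 2 * d := by
      rintro x (hx | ⟨y, hy, rfl⟩)
      · have := hdR x hx
        linarith
      · have h1 := hdR y hy
        have h2 : ‖(-M) • e‖ = M := by
          rw [norm_smul, he, norm_neg, Real.norm_of_nonneg hM.le, mul_one]
        have h3 := norm_add_le (y - x₀) ((-M) • e)
        rw [h2, ← add_sub_right_comm] at h3
        exact h3.trans (by linarith)
    have hup : ∀ x ∈ S', inner ℝ (f (x + M • e) - f x) e ≤ 2 * Q * L := by
      intro x hx
      have hd0 : 0 < d := hM.trans_le hMd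
      have hvx : ‖x₀ + v - x₀‖ = d := by rw [add_sub_cancel_left, hv]
      have h1 := hnear x hx
      have q1 := hQ f hf x₀ (x₀ + v) x (by rw [hvx]; nlinarith)
      have q2 := hQ f hf x₀ (x₀ + v) (x + M • e) (by
        rw [hvx, add_sub_right_comm]
        refine (norm_add_le _ _).trans ?_
        rw [norm_smul, he, Real.norm_of_nonneg hM.le]
        nlinarith)
      have q3 := norm_sub_le_norm_sub_add_norm_sub (f (x + M • e)) (f x₀) (f x)
      rw [norm_sub_rev (f x₀)] at q3
      have q4 := real_inner_le_norm (f (x + M • e) - f x) e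
      rw [he, mul_one] at q4
      linarith
    have key := hf.mul_setIntegral_norm_fderiv_le hn hP0 hP
      (hRc.union htc).measurableSet (hRb.union htb) he hM hout hup
    calc d * I ≤ n * M * I := by gcongr
      _ = n * (M * I) := by ring
      _ ≤ n * (P / δ * (2 * Q * L * volume.real S')) := by gcongr
      _ ≤ n * (P / δ * (2 * Q * L * (2 * volume.real R))) := by gcongr
      _ = n * (P / δ * (2 * Q * 2)) * (L * volume.real R) := by ring

namespace IsDeltaMonotone

variable {n : ℕ} {δ : ℝ} {f : EuclideanSpace ℝ (Fin n) → EuclideanSpace ℝ (Fin n)}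

/-- Intersecting congruent boxes have equal diameter and volume, and the oscillation in
`exists_box_bounds` may be measured at a common point. -/
theorem exists_setIntegral_le_mul (hn : 2 ≤ n) (hf : IsDeltaMonotone δ f)
    (hnc : ∃ x y, f x ≠ f y) :
    ∃ A : ℝ, 1 ≤ A ∧ ∀ R₁ R₂ : Set (EuclideanSpace ℝ (Fin n)), IsRectangularBox R₁ →
      IsRectangularBox R₂ → AreCongruent R₁ R₂ → (R₁ ∩ R₂).Nonempty →
        0 < ∫ x in R₁, ‖fderiv ℝ f x‖ ∧ 0 < ∫ x in R₂, ‖fderiv ℝ f x‖ ∧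
        ∫ x in R₁, ‖fderiv ℝ f x‖ ≤ A * ∫ x in R₂, ‖fderiv ℝ f x‖ ∧
        ∫ x in R₂, ‖fderiv ℝ f x‖ ≤ A * ∫ x in R₁, ‖fderiv ℝ f x‖ := by
  obtain ⟨c, C, hc, hC, h⟩ := exists_box_bounds hn hf.1
  refine ⟨max 1 (C / c), le_max_left _ _, fun R₁ R₂ h1 h2 hg hne => ?_⟩
  obtain ⟨x₀, hx1, hx2⟩ := hne
  obtain ⟨g, rfl⟩ := hg
  obtain ⟨-, -, hvol, e, M, -, he, hM, hMd, -⟩ := h1.exists_slabs hn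
  set d := Metric.diam R₁ with hd
  have hd0 : 0 < d := hM.trans_le hMd
  have hv : ‖d • e‖ = d := by rw [norm_smul, he, Real.norm_of_nonneg hd0.le, mul_one]
  have b1 := h f hf R₁ h1 x₀ hx1 (d • e) hv
  have b2 := h f hf (g '' R₁) h2 x₀ hx2 (d • e) (by rw [g.diam_image, hv])
  have hvol2 : volume.real (g '' R₁) = volume.real R₁ := by
    rw [measureReal_def, g.volume_image, measureReal_def]
  rw [g.diam_image, hvol2] at b2
  have hL : 0 < ‖f (x₀ + d • e) - f x₀‖ * volume.real R₁ := by
    refine mul_pos (norm_pos_iff.2 (sub_ne_zero.2 fun hcon => ?_)) hvol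
    have := hf.injective hn hnc hcon
    rw [add_eq_left, ← norm_eq_zero, hv] at this
    exact hd0.ne' this
  set X := ‖f (x₀ + d • e) - f x₀‖ * volume.real R₁
  have hcX : 0 < c * X := mul_pos hc hL
  have aux : ∀ I J : ℝ, d * I ≤ C * X → c * X ≤ d * J → I ≤ max 1 (C / c) * J := by
    intro I J hI hJ
    have hJ0 : 0 < J := pos_of_mul_pos_right (hcX.trans_le hJ) hd0.le
    refine le_trans ?_ (mul_le_mul_of_nonneg_right (le_max_right 1 (C / c)) hJ0.le)
    refine le_of_mul_le_mul_left ?_ hd0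
    calc d * I ≤ C * X := hI
      _ = C / c * (c * X) := by field_simp
      _ ≤ C / c * (d * J) := by gcongr
      _ = _ := by ring
  exact ⟨pos_of_mul_pos_right (hcX.trans_le b1.1) hd0.le,
    pos_of_mul_pos_right (hcX.trans_le b2.1) hd0.le, aux _ _ b1.2 b2.1, aux _ _ b2.2 b1.1⟩

theorem isIsotropicDoublingWeight (hn : 2 ≤ n) (hf : IsDeltaMonotone δ f)
    (hnc : ∃ x y, f x ≠ f y) : IsIsotropicDoublingWeight (fun x => ‖fderiv ℝ f x‖) := by
  have hli := hf.locallyIntegrable_fderiv hn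
  refine ⟨⟨fun x => norm_nonneg _, fun x => (hli x).norm⟩, ?_, ?_⟩
  · refine ⟨fun x => ⟨Metric.closedBall x 1, Metric.closedBall_mem_nhds x one_pos, ?_⟩⟩
    rw [withDensity_apply _ Metric.isClosed_closedBall.measurableSet]
    exact (hf.integrableOn_fderiv hn Metric.isBounded_closedBall).norm.lintegral_lt_top
  · obtain ⟨A, hA1, hA⟩ := hf.exists_setIntegral_le_mul hn hnc
    refine ⟨A.toNNReal, Real.one_le_toNNReal.2 hA1, fun R₁ R₂ h1 h2 hg hne => ?_⟩
    have hμ : ∀ R, IsRectangularBox R →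
        volume.withDensity (fun x => ENNReal.ofReal ‖fderiv ℝ f x‖) R
          = ENNReal.ofReal (∫ x in R, ‖fderiv ℝ f x‖) := fun R hR => by
      obtain ⟨hRc, hRb, -⟩ := hR.exists_slabs hn
      rw [withDensity_apply _ hRc.measurableSet, ofReal_integral_eq_lintegral_ofReal
        (hf.integrableOn_fderiv hn hRb).norm (Filter.Eventually.of_forall fun x => norm_nonneg _)]
    obtain ⟨p1, p2, l1, l2⟩ := hA R₁ R₂ h1 h2 hg hne
    have hA0 : 0 < A := one_pos.trans_le hA1
    rw [hμ R₁ h1, hμ R₂ h2, ← ENNReal.ofReal_div_of_pos p2]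
    change (ENNReal.ofReal A)⁻¹ ≤ _ ∧ _ ≤ ENNReal.ofReal A
    rw [← ENNReal.ofReal_inv_of_pos hA0]
    constructor
    · refine ENNReal.ofReal_le_ofReal ?_
      rw [le_div_iff₀ p2, inv_mul_le_iff₀ hA0]
      exact l2
    · refine ENNReal.ofReal_le_ofReal ?_
      rw [div_le_iff₀ p2]
      exact l1

end IsDeltaMonotone

theorem theorem1p4 {n : ℕ} (hn : 2 ≤ n) {δ : ℝ}
    (f : EuclideanSpace ℝ (Fin n) → EuclideanSpace ℝ (Fin n))
    (hf : IsDeltaMonotone δ f) (hnc : ∃ x y, f x ≠ f y) :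
    (∀ᵐ x, DifferentiableAt ℝ f x) ∧ HasWeakDerivative f (fderiv ℝ f) ∧
      IsIsotropicDoublingWeight (fun x => ‖fderiv ℝ f x‖) :=
  ⟨hf.ae_differentiableAt (hf.continuous hn), hf.hasWeakDerivative_fderiv hn,
    hf.isIsotropicDoublingWeight hn hnc⟩
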